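/- **Setting.** Let $n\ge 1$, let $\mathcal F\subset\mathbb R^n$ be convex and compact, contained in the Euclidean unit ball, and let $\mathcal R$ be a $\vartheta$-self-concordant barrier for $\mathcal F$ with $\min\mathcal R=0$: on $\operatorname{int}\mathcal F$ it is convex and $C^3$, tends to $+\infty$ at the boundary, and satisfies $|D^3\mathcal R(x)[u,u,u]|\le 2(D^2\mathcal R(x)[u,u])^{3/2}$ and $(D\mathcal R(x)[u])^2\le\vartheta D^2\mathcal R(x)[u,u]$. Let $\mathcal X$ be a subset of the Euclidean unit ball, let $\Pi$ be a finite non-empty set of models, $d=|\Pi|$, $T\in\mathbb N$ and $\eta>0$. In round $t$ Nature's move is $x_t\in\mathcal X$ and model $\pi$ predicts $M_t^\pi$, $\|M^\pi_t\|\le 1$, with $M^\pi_1=0$. Both $x_t$ and $(M_t^\pi)_\pi$ may depend on a discrete random seed independent of the learner's draws and on all draws of the learner in rounds $1,\dots,t-1$. They are called *oblivious* if they depend on $t$ and the seed only. **Algorithm** (only $\langle f_t,x_t\rangle$ and $M_t^{\pi_t}$ are observed in round $t$). In rounds $t=1,\dots,T$: 1. *Choice of the model* (SCRiBLe for multi-armed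 bandits with step size $\eta'=1/(32d^2)$). Let $\mathcal R'(h)=-\sum_{i=1}^{d-1}\log h[i]-\log\big(1-\sum_{i=1}^{d-1}h[i]\big)$ and let $h'_t$ minimise $\eta'\langle h,\sum_{s<t}\tilde x'_s\rangle+\mathcal R'(h)$ over the open simplex $\{h\in\mathbb R^{d-1}: h[i]>0,\ \sum_i h[i]<1\}$ (so $h_1'$ is uniform). Let $e'_j,\lambda'_j$ be an orthonormal eigenbasis and the eigenvalues of $\nabla^2\mathcal R'(h'_t)$. Draw $j_t\in\{1,\dots,d-1\}$ and a sign $\varepsilon'_t=\pm1$ uniformly, let $g_t=h'_t+\varepsilon'_t(\lambda'_{j_t})^{-1/2}e'_{j_t}$, $q_t=(g_t,1-\sum_i g_t[i])$, and draw $\pi_t\sim q_t$. (If $d=1$, the only model is always chosen.) 2. *Decision.* Let $h_1=\arg\min_{\mathcal F}\mathcal R$ and, for $t\ge2$, $h_t=\arg\min_{h\in\mathcal F}\big[\eta\langle h,\sum_{s<t}\tilde x_s+M_t^{\pi_t}\rangle+\mathcal R(h)\big]$. Let $e_i,\lambda_i$ be an orthonormal eigenbasis and the eigenvalues of $\nabla^2\mathcal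 R(h_t)$. Draw $i_t\in\{1,\dots,n\}$ and a sign $\varepsilon_t=\pm1$ uniformly, and play $f_t=h_t+\varepsilon_t\lambda_{i_t}^{-1/2}e_{i_t}$. 3. *Estimates.* $\tilde x_t=n\langle f_t,x_t-M_t^{\pi_t}\rangle\varepsilon_t\lambda_{i_t}^{1/2}e_{i_t}+M_t^{\pi_t}$ and $\tilde x'_t=d\,\langle f_t,x_t-M_t^{\pi_t}\rangle^2\varepsilon'_t(\lambda'_{j_t})^{1/2}e'_{j_t}$. The eigenbases are arbitrary, chosen as a function of the point $h_t$, respectively $h'_t$. **Statement.** Suppose that $\eta\, n\,|\langle f_t,x_t-M_t^{\pi_t}\rangle|<1/4$ in every round $t\le T$ (this holds if $\eta<1/(8n)$). Then, for every $f^*\in\operatorname{int}\mathcal F$, with expectations over the learner's draws and the seed, $$\mathbb E\Big[\sum_{t=1}^T\langle f_t,x_t\rangle-\sum_{t=1}^T\langle f^*,x_t\rangle\Big]\le\eta^{-1}\mathcal R(f^*)+2\eta n^2\,\mathbb E\sum_{t=1}^T\langle f_t,x_t-M_t^{\pi_t}\rangle^2 .$$ If the moves and predictions are oblivious, the right-hand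 side is at most $$\eta^{-1}\mathcal R(f^*)+4\eta n^2\Big(\mathbb E\Big[\inf_{\pi\in\Pi}\sum_{t=1}^T\|x_t-M^\pi_t\|^2\Big]+32|\Pi|^3\log(T|\Pi|)\Big).$$ Without obliviousness, the right-hand side of the first inequality is at most the same expression with $\inf_{\pi\in\Pi}\mathbb E\sum_{t=1}^T\|x_t-M^\pi_t\|^2$ in place of $\mathbb E\inf_{\pi\in\Pi}\sum_{t=1}^T\|x_t-M^\pi_t\|^2$. (For $T=0$ the logarithm is read as $0$.) -/

import Mathlib

noncomputable section

/-! ### Self-concordant barriers, minimisers and eigenbases -/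

/-- `R` is a `ϑ`-self-concordant barrier for the set `F`: on the interior of `F` it is three times
continuously differentiable and convex, it tends to `+∞` at the boundary of `F`, and it satisfies
`|D³R(x)[u,u,u]| ≤ 2 (D²R(x)[u,u])^{3/2}` and `(DR(x)[u])² ≤ ϑ D²R(x)[u,u]`.
Outside the interior of `F` the barrier is `+∞`; the real value of `R` there is never used. -/
structure IsSelfConcordantBarrier {n : ℕ} (ϑ : ℝ) (F : Set (EuclideanSpace ℝ (Fin n)))
    (R : EuclideanSpace ℝ (Fin n) → ℝ) : Prop where
  contDiffOn : ContDiffOn ℝ 3 R (interior F)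
  convexOn : ConvexOn ℝ (interior F) R
  tendsto_atTop : ∀ y ∈ frontier F,
    Filter.Tendsto R (nhdsWithin y (interior F)) Filter.atTop
  third_le : ∀ x ∈ interior F, ∀ u : EuclideanSpace ℝ (Fin n),
    |iteratedFDeriv ℝ 3 R x ![u, u, u]| ≤ 2 * (iteratedFDeriv ℝ 2 R x ![u, u]) ^ (3 / 2 : ℝ)
  first_le : ∀ x ∈ interior F, ∀ u : EuclideanSpace ℝ (Fin n),
    (fderiv ℝ R x u) ^ 2 ≤ ϑ * iteratedFDeriv ℝ 2 R x ![u, u]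

/-- A minimiser of `φ` over `C` (an arbitrary point if there is none). -/
def argminOn {V : Type*} [Nonempty V] (C : Set V) (φ : V → ℝ) : V :=
  Classical.epsilon fun h => h ∈ C ∧ IsMinOn φ C h

/-- `vec h`, `val h` are an orthonormal basis of eigenvectors of the Hessian `∇²R(h)` and the
corresponding eigenvalues, for every `h ∈ C`. -/
def IsHessianEigenbasis {n : ℕ} (C : Set (EuclideanSpace ℝ (Fin n)))
    (R : EuclideanSpace ℝ (Fin n) → ℝ)
    (vec : EuclideanSpace ℝ (Fin n) →
      OrthonormalBasis (Fin n) ℝ (EuclideanSpace ℝ (Fin n)))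
    (val : EuclideanSpace ℝ (Fin n) → Fin n → ℝ) : Prop :=
  ∀ h ∈ C, ∀ (i : Fin n) (v : EuclideanSpace ℝ (Fin n)),
    iteratedFDeriv ℝ 2 R h ![vec h i, v] = val h i * inner ℝ (vec h i) v

/-- The random sign `±1`, coded by a Boolean. -/
def signOf (b : Bool) : ℝ := if b then 1 else -1

/-! ### The barrier of the probability simplex over `m + 1` arms, in the first `m` coordinates -/

/-- The open simplex `{h : h[i] > 0, ∑ h[i] < 1}` in `ℝ^m`. -/
def openSimplex (m : ℕ) : Set (EuclideanSpace ℝ (Fin m)) :=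
  {h | (∀ i, 0 < h i) ∧ ∑ i, h i < 1}

/-- `- ∑ᵢ log h[i] - log (1 - ∑ᵢ h[i])`. -/
def simplexBarrier (m : ℕ) (h : EuclideanSpace ℝ (Fin m)) : ℝ :=
  -(∑ i, Real.log (h i)) - Real.log (1 - ∑ i, h i)

/-- The distribution `(f, 1 - ∑ᵢ f[i])` on the `m + 1` arms. -/
def armDist {m : ℕ} (f : EuclideanSpace ℝ (Fin m)) : Fin (m + 1) → ℝ :=
  Fin.snoc (α := fun _ => ℝ) (fun i => f i) (1 - ∑ i, f i)

/-! ### The learner, Nature, and the random draws -/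

/-- The inputs of the algorithm for a learner in `ℝ^n` with the `m + 1` models `Fin (m + 1)`:
the decision set, the barrier, the step size, and the eigenvectors and eigenvalues that are used
for the Hessians of `R` and of the simplex barrier. -/
structure Learner (n m : ℕ) where
  F : Set (EuclideanSpace ℝ (Fin n))
  R : EuclideanSpace ℝ (Fin n) → ℝ
  η : ℝ
  vec : EuclideanSpace ℝ (Fin n) → OrthonormalBasis (Fin n) ℝ (EuclideanSpace ℝ (Fin n))
  val : EuclideanSpace ℝ (Fin n) → Fin n → ℝ
  armVec : EuclideanSpace ℝ (Fin m) → OrthonormalBasis (Fin m) ℝ (EuclideanSpace ℝ (Fin m))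
  armVal : EuclideanSpace ℝ (Fin m) → Fin m → ℝ

/-- The random draws of the learner in one round: the eigenvector index and the sign used by the
bandit algorithm over the models, the model drawn, and the eigenvector index and the sign used for
the decision. A single model leaves no eigenvector to choose from: then the first index has one
(irrelevant) value. -/
abbrev Draw (n m : ℕ) : Type :=
  (Fin (max 1 m) × Bool) × Fin (m + 1) × (Fin n × Bool)

/-- The model `π_t` drawn in the round. -/
abbrev Draw.model {n m : ℕ} (c : Draw n m) : Fin (m + 1) := c.2.1

/-- Nature's moves `x_t` and the predictions `M_t^π` of the models. Both may depend on all draws of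
the learner in the rounds before `t`; a history lists them with the latest round first, so that
round `t` corresponds to histories of length `t - 1`. -/
structure Environment (n m : ℕ) where
  move : List (Draw n m) → EuclideanSpace ℝ (Fin n)
  pred : Fin (m + 1) → List (Draw n m) → EuclideanSpace ℝ (Fin n)

/-- Moves and predictions are oblivious: they depend on the round, not on the learner's draws. -/
def Environment.Oblivious {n m : ℕ} (N : Environment n m) : Prop :=
  ∀ past past' : List (Draw n m), past.length = past'.length →
    N.move past = N.move past' ∧ ∀ k, N.pred k past = N.pred k past'

namespace Learner

variable {n m : ℕ} (L : Learner n m) (N : Environment n m)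

/-- `h + ε λ_i^{-1/2} e_i`, where `e_i`, `λ_i` are the eigenvectors and eigenvalues at `h`. -/
def perturb (h : EuclideanSpace ℝ (Fin n)) (i : Fin n) (b : Bool) : EuclideanSpace ℝ (Fin n) :=
  h + (signOf b * (Real.sqrt (L.val h i))⁻¹) • L.vec h i

/-- The estimate `n (loss - ⟨f, M⟩) ε λ_i^{1/2} e_i + M` of Nature's move, computed from the
observed loss and the one observed prediction `M`, where `f = h + ε λ_i^{-1/2} e_i`. -/
def estimate (h : EuclideanSpace ℝ (Fin n)) (i : Fin n) (b : Bool) (loss : ℝ)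
    (M : EuclideanSpace ℝ (Fin n)) : EuclideanSpace ℝ (Fin n) :=
  (n * (loss - inner ℝ (L.perturb h i b) M) * signOf b * Real.sqrt (L.val h i)) • L.vec h i + M

/-- `argmin_{h ∈ F} η ⟨h, S⟩ + R(h)`. -/
def leader (S : EuclideanSpace ℝ (Fin n)) : EuclideanSpace ℝ (Fin n) :=
  argminOn (interior L.F) fun h => L.η * inner ℝ h S + L.R h

/-- The guess `M_t^π` that is added to the past estimates in the update of `h_t`; the first
point `h_1` is the minimiser of `R` and uses no guess. -/
def guess : List (Draw n m) → Fin (m + 1) → EuclideanSpace ℝ (Fin n)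
  | [], _ => 0
  | c :: past, k => N.pred k (c :: past)

/-- The sum of the estimated moves of the rounds of a history. -/
def estSum : List (Draw n m) → EuclideanSpace ℝ (Fin n)
  | [] => 0
  | c :: past =>
    let h := L.leader (estSum past + guess N past c.model)
    estSum past + L.estimate h c.2.2.1 c.2.2.2
      (inner ℝ (L.perturb h c.2.2.1 c.2.2.2) (N.move past)) (N.pred c.model past)

/-- The point `h_t` after the history `past`, if the model drawn for round `t` is `k`. -/
def center (past : List (Draw n m)) (k : Fin (m + 1)) : EuclideanSpace ℝ (Fin n) :=
  L.leader (L.estSum N past + guess N past k)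

/-- The decision `f_t` of the learner. -/
def decision (past : List (Draw n m)) (c : Draw n m) : EuclideanSpace ℝ (Fin n) :=
  L.perturb (L.center N past c.model) c.2.2.1 c.2.2.2

/-- The observable quantity `⟨f_t, x_t⟩ - ⟨f_t, M_t^{π_t}⟩`. -/
def gap (past : List (Draw n m)) (c : Draw n m) : ℝ :=
  inner ℝ (L.decision N past c) (N.move past) -
    inner ℝ (L.decision N past c) (N.pred c.model past)

/-! The bandit algorithm over the `m + 1` models, with step size `1 / (32 (m + 1)²)`. -/

/-- `argmin_h (32 (m + 1)²)⁻¹ ⟨h, S⟩ + simplexBarrier h`. For `S = 0` it is the uniform point. -/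
def armLeader (S : EuclideanSpace ℝ (Fin m)) : EuclideanSpace ℝ (Fin m) :=
  argminOn (openSimplex m) fun h =>
    (1 / (32 * ((m : ℝ) + 1) ^ 2)) * inner ℝ h S + simplexBarrier m h

/-- `h + ε λ_j^{-1/2} e_j` (just `h` if there is a single model). -/
def armPerturb (h : EuclideanSpace ℝ (Fin m)) (j : Fin (max 1 m)) (b : Bool) :
    EuclideanSpace ℝ (Fin m) :=
  if hj : j.val < m then
    h + (signOf b * (Real.sqrt (L.armVal h ⟨j.val, hj⟩))⁻¹) • L.armVec h ⟨j.val, hj⟩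
  else h

/-- The estimate `(m + 1) · loss · ε λ_j^{1/2} e_j` of the bandit algorithm. -/
def armEstimate (h : EuclideanSpace ℝ (Fin m)) (j : Fin (max 1 m)) (b : Bool) (loss : ℝ) :
    EuclideanSpace ℝ (Fin m) :=
  if hj : j.val < m then
    (((m : ℝ) + 1) * loss * signOf b * Real.sqrt (L.armVal h ⟨j.val, hj⟩)) •
      L.armVec h ⟨j.val, hj⟩
  else 0

/-- The sum of the estimates of the bandit algorithm; the loss of the drawn model `π_t` is
`(⟨f_t, x_t⟩ - ⟨f_t, M_t^{π_t}⟩)²`. -/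
def armEstSum : List (Draw n m) → EuclideanSpace ℝ (Fin m)
  | [] => 0
  | c :: past =>
    armEstSum past +
      L.armEstimate (armLeader (armEstSum past)) c.1.1 c.1.2 ((L.gap N past c) ^ 2)

/-- The distribution `q_t` from which the model `π_t` is drawn, given the draws `j`, `b` of the
bandit algorithm in round `t`. -/
def modelDist (past : List (Draw n m)) (j : Fin (max 1 m)) (b : Bool) : Fin (m + 1) → ℝ :=
  armDist (L.armPerturb (armLeader (L.armEstSum N past)) j b)

/-- The conditional probability of the draws `c` of a round, given the history: indices and signs
are uniform, and the model has the distribution `q_t`. -/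
def drawProb (past : List (Draw n m)) (c : Draw n m) : ℝ :=
  ((max 1 m : ℕ) : ℝ)⁻¹ * (1 / 2) * L.modelDist N past c.1.1 c.1.2 c.model * ((n : ℝ)⁻¹ * (1 / 2))

/-- The expectation, over the draws of the learner in `T` rounds, of a function of the history. -/
def expect : ℕ → (List (Draw n m) → ℝ) → ℝ
  | 0, g => g []
  | T + 1, g => expect T fun past => ∑ c : Draw n m, L.drawProb N past c * g (c :: past)

end Learner

/-- The sum of `φ (history before round t) (draws of round t)` over all rounds of a history. -/
def cumulative {n m : ℕ} (φ : List (Draw n m) → Draw n m → ℝ) : List (Draw n m) → ℝ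
  | [] => 0
  | c :: past => cumulative φ past + φ past c

/-- The expectation over a private seed `ω` of the environment, independent of the learner, and over
the draws of the learner in `T` rounds. -/
def gameExpect {n m : ℕ} {Ω : Type*} (p : PMF Ω) (L : Learner n m) (N : Ω → Environment n m)
    (T : ℕ) (g : Ω → List (Draw n m) → ℝ) : ℝ :=
  ∑' ω, (p ω).toReal * L.expect (N ω) T (g ω)

end

noncomputable section

open Set Filter Topology

/-! Both levels of the algorithm are follow-the-regularised-leader with a self-concordant barrier,
so one deterministic inequality serves twice. Let Φ(S) be the minimum of η⟨h,S⟩ + R(h). If h is the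
leader computed with guess M and z is the move then revealed, η⟨h,z⟩ ≤ Φ(S+z) − Φ(S) + 2δ², where δ
≤ 1/2 bounds the dual local norm of η(z − M) (`inner_le_potential_sub`). The reason is that the
gradient of a self-concordant function is strongly monotone in the local norm, so the minimiser
moves by at most 2δ. The inequalities telescope, Φ(0) ≥ 0, and Φ(S) ≤ η⟨f*,S⟩ + R(f*).

Decisions: the estimate minus the guess is ±n·gap·λ^{1/2}e, of dual local norm at most n|gap|. Given
the past and the drawn model, averaging over index and sign turns the estimate into x_t and the
decision into h_t, so the regret against estimated moves and the true regret have the same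
expectation (`expect_regret_le`).

Models: the loss gap² lies in [0,4]. With step size η' = 1/(32d²) the error 2δ² is at most η'
gap²/4, so the cumulative loss reappears on the right with factor 1/4 and is absorbed
(`expect_gap_sq_le`). The comparator is a vertex of the simplex moved by 1/T towards the barycentre,
with barrier value at most d log(Td). Cauchy–Schwarz bounds gap² by the squared error of the model.

For adaptive play the comparator model is fixed before averaging, which gives inf 𝔼. For oblivious
play the errors are deterministic given the seed, so the model may be chosen seed by seed, which
gives 𝔼 inf. -/

/-- `R` is a self-concordant function on the open bounded convex set `C` that tends to `+∞` at the
boundary of `C`. -/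
structure SelfConcordantOn {n : ℕ} (C : Set (EuclideanSpace ℝ (Fin n)))
    (R : EuclideanSpace ℝ (Fin n) → ℝ) : Prop where
  isOpen : IsOpen C
  convex : Convex ℝ C
  isBounded : Bornology.IsBounded C
  contDiffOn : ContDiffOn ℝ 3 R C
  hess_nonneg : ∀ x ∈ C, ∀ u : EuclideanSpace ℝ (Fin n),
    0 ≤ iteratedFDeriv ℝ 2 R x (fun _ => u)
  third_le : ∀ x ∈ C, ∀ u : EuclideanSpace ℝ (Fin n),
    |iteratedFDeriv ℝ 3 R x (fun _ => u)| ≤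
      2 * (iteratedFDeriv ℝ 2 R x (fun _ => u)) ^ (3 / 2 : ℝ)
  tendsto_atTop : ∀ y ∈ frontier C, Tendsto R (𝓝[C] y) atTop

/-! ### Derivatives along lines. -/

theorem hasDerivAt_iteratedFDeriv_line {E : Type*} [NormedAddCommGroup E] [NormedSpace ℝ E]
    {R : E → ℝ} {N : WithTop ℕ∞} {k : ℕ} (hk : k < N) (x u : E) (t : ℝ)
    (h : ContDiffAt ℝ N R (x + t • u)) :
    HasDerivAt (fun s : ℝ => iteratedFDeriv ℝ k R (x + s • u) (fun _ => u))
      (iteratedFDeriv ℝ (k + 1) R (x + t • u) (fun _ => u)) t := by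
  have h1 : DifferentiableAt ℝ (iteratedFDeriv ℝ k R) (x + t • u) :=
    h.differentiableAt_iteratedFDeriv hk
  have h2 : HasDerivAt (fun s : ℝ => x + s • u) u t := by
    simpa using ((hasDerivAt_id t).smul_const u).const_add x
  have h3 := h1.hasFDerivAt.comp_hasDerivAt t h2
  have h4 := (ContinuousMultilinearMap.apply ℝ (fun _ : Fin k => E) ℝ
    (fun _ => u)).hasFDerivAt.comp_hasDerivAt t h3
  exact h4

theorem hasDerivAt_line {E : Type*} [NormedAddCommGroup E] [NormedSpace ℝ E]
    {R : E → ℝ} {N : WithTop ℕ∞} (hN : 0 < N) (x u : E) (t : ℝ)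
    (h : ContDiffAt ℝ N R (x + t • u)) :
    HasDerivAt (fun s : ℝ => R (x + s • u))
      (iteratedFDeriv ℝ 1 R (x + t • u) (fun _ => u)) t := by
  simpa using hasDerivAt_iteratedFDeriv_line (k := 0) (by simpa using hN) x u t h

/-- The derivative of φ^{-1/2} is −½ φ' φ^{-3/2}, and self-concordance is exactly the bound that
makes this at most 1 in absolute value. -/
theorem abs_rpow_neg_half_sub_le {φ φ' : ℝ → ℝ} {s : Set ℝ} (hs : Convex ℝ s)
    (hφ : ∀ t ∈ s, HasDerivAt φ (φ' t) t) (hpos : ∀ t ∈ s, 0 < φ t)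
    (hbound : ∀ t ∈ s, |φ' t| ≤ 2 * φ t ^ (3 / 2 : ℝ)) {a b : ℝ} (ha : a ∈ s) (hb : b ∈ s) :
    |(φ b) ^ (-(1 / 2) : ℝ) - (φ a) ^ (-(1 / 2) : ℝ)| ≤ |b - a| := by
  have key : ∀ t ∈ s, HasDerivWithinAt (fun t => (φ t) ^ (-(1 / 2) : ℝ))
      (φ' t * (-(1 / 2) : ℝ) * (φ t) ^ ((-(1 / 2) : ℝ) - 1)) s t := fun t ht =>
    ((hφ t ht).rpow_const (Or.inl (hpos t ht).ne')).hasDerivWithinAt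
  have := hs.norm_image_sub_le_of_norm_hasDerivWithin_le (C := 1) key (fun t ht => ?_) ha hb
  · simpa using this
  · have hp := hpos t ht
    have h1 : 0 < (φ t) ^ (-(3 / 2) : ℝ) := Real.rpow_pos_of_pos hp _
    have h2 : (φ t) ^ (-(3 / 2) : ℝ) * (φ t) ^ (3 / 2 : ℝ) = 1 := by
      rw [← Real.rpow_add hp]; norm_num
    have h3 : ((-(1 / 2) : ℝ) - 1) = -(3 / 2) := by norm_num
    rw [h3, Real.norm_eq_abs, abs_mul, abs_mul, abs_of_pos h1]
    have h4 := hbound t ht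
    have h5 : |(-(1 / 2) : ℝ)| = 1 / 2 := by norm_num [abs_of_neg]
    rw [h5]
    nlinarith

/-! ### Self-concordant functions: Dikin ellipsoid, minimisers and their stability. -/

namespace SelfConcordantOn

variable {n : ℕ} {C : Set (EuclideanSpace ℝ (Fin n))} {R : EuclideanSpace ℝ (Fin n) → ℝ}

theorem contDiffAt (h : SelfConcordantOn C R) {x : EuclideanSpace ℝ (Fin n)} (hx : x ∈ C) :
    ContDiffAt ℝ 3 R x :=
  h.contDiffOn.contDiffAt (h.isOpen.mem_nhds hx)

/-- The local Hessian norm along a segment: `(D²R + ε)^{-1/2}` is `1`-Lipschitz. -/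
theorem abs_hess_rpow_sub_le (h : SelfConcordantOn C R) {x u : EuclideanSpace ℝ (Fin n)}
    {s : Set ℝ} (hs : Convex ℝ s) (hC : ∀ t ∈ s, x + t • u ∈ C) {ε : ℝ} (hε : 0 ≤ ε)
    (hpos : ∀ t ∈ s, 0 < iteratedFDeriv ℝ 2 R (x + t • u) (fun _ => u) + ε)
    {a b : ℝ} (ha : a ∈ s) (hb : b ∈ s) :
    |(iteratedFDeriv ℝ 2 R (x + b • u) (fun _ => u) + ε) ^ (-(1 / 2) : ℝ) -
      (iteratedFDeriv ℝ 2 R (x + a • u) (fun _ => u) + ε) ^ (-(1 / 2) : ℝ)| ≤ |b - a| := by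
  refine abs_rpow_neg_half_sub_le (φ := fun t => iteratedFDeriv ℝ 2 R (x + t • u) (fun _ => u) + ε)
    hs (fun t ht => (hasDerivAt_iteratedFDeriv_line (N := 3) (by norm_num) x u t
      (h.contDiffAt (hC t ht))).add_const ε) hpos (fun t ht => ?_) ha hb
  refine (h.third_le _ (hC t ht) u).trans ?_
  have := h.hess_nonneg _ (hC t ht) u
  gcongr
  linarith

/-- The open Dikin ellipsoid is contained in the domain. -/
theorem add_mem (h : SelfConcordantOn C R) {x u : EuclideanSpace ℝ (Fin n)} (hx : x ∈ C)
    (hu : iteratedFDeriv ℝ 2 R x (fun _ => u) < 1) : x + u ∈ C := by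
  by_contra hout
  -- The shift ε replaces strict positivity of the Hessian, which is only deduced later, in
  -- `hess_pos`, from this very lemma.
  obtain ⟨ε, hε, hε1⟩ : ∃ ε : ℝ, 0 < ε ∧ iteratedFDeriv ℝ 2 R x (fun _ => u) + ε < 1 :=
    ⟨(1 - iteratedFDeriv ℝ 2 R x (fun _ => u)) / 2, by linarith, by linarith⟩
  have hline : Continuous fun t : ℝ => x + t • u := by fun_prop
  set B : Set ℝ := Icc 0 1 ∩ (fun t : ℝ => x + t • u) ⁻¹' Cᶜ with hB
  have hBc : IsClosed B := isClosed_Icc.inter (h.isOpen.isClosed_compl.preimage hline)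
  have hBn : B.Nonempty := ⟨1, ⟨by simp, by simpa using hout⟩⟩
  have hBb : BddBelow B := ⟨0, fun t ht => ht.1.1⟩
  set τ := sInf B with hτ
  have hτB : τ ∈ B := hBc.csInf_mem hBn hBb
  have hτ0 : 0 < τ := by
    rcases hτB.1.1.lt_or_eq with h0 | h0
    · exact h0
    · exact absurd (by rw [← h0]; simpa using hx) hτB.2
  have hin : ∀ t ∈ Ico 0 τ, x + t • u ∈ C := by
    intro t ht
    by_contra hcon
    exact absurd (csInf_le hBb (show t ∈ B from ⟨⟨ht.1, ht.2.le.trans hτB.1.2⟩, hcon⟩))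
      (not_le.2 ht.2)
  have h0 : (0 : ℝ) ∈ Ico 0 τ := ⟨le_rfl, hτ0⟩
  set ρ := iteratedFDeriv ℝ 2 R x (fun _ => u) + ε with hρ
  have hρ0 : 0 < ρ := by have := h.hess_nonneg x hx u; linarith
  -- The inverse root of the shifted Hessian starts at ρ^{-1/2} > 1 and drops by at most 1 before
  -- the exit time τ, so it stays above κ. Hence the Hessian, the gradient and `R` are bounded up to
  -- τ, although `R` must blow up at the exit point.
  set κ := ρ ^ (-(1 / 2) : ℝ) - 1 with hκ
  have hκ0 : 0 < κ := by
    have := Real.one_lt_rpow_of_pos_of_lt_one_of_neg hρ0 hε1 (z := -(1 / 2)) (by norm_num)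
    linarith
  have hess : ∀ t ∈ Ico 0 τ, |iteratedFDeriv ℝ 2 R (x + t • u) (fun _ => u)| ≤
      κ ^ (-2 : ℝ) := by
    intro t ht
    have hnn := h.hess_nonneg _ (hin t ht) u
    have hp : 0 < iteratedFDeriv ℝ 2 R (x + t • u) (fun _ => u) + ε := by linarith
    have key := h.abs_hess_rpow_sub_le (convex_Ico 0 τ) hin hε.le
      (fun s hs => by have := h.hess_nonneg _ (hin s hs) u; linarith) h0 ht
    rw [zero_smul, add_zero, ← hρ, sub_zero, abs_of_nonneg ht.1] at key
    have h1 : κ ≤ (iteratedFDeriv ℝ 2 R (x + t • u) (fun _ => u) + ε) ^ (-(1 / 2) : ℝ) := by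
      have := (abs_le.1 key).1
      have := ht.2.trans_le hτB.1.2
      linarith
    have h2 := Real.rpow_le_rpow_of_nonpos hκ0 h1 (z := -2) (by norm_num)
    rw [← Real.rpow_mul hp.le] at h2
    norm_num at h2
    rw [abs_of_nonneg hnn]
    norm_num
    linarith
  set K := κ ^ (-2 : ℝ) with hK
  have hK0 : 0 ≤ K := Real.rpow_nonneg hκ0.le _
  have habs : ∀ t ∈ Ico (0 : ℝ) τ, |t - 0| ≤ 1 := fun t ht => by
    rw [sub_zero, abs_of_nonneg ht.1]; exact ht.2.le.trans hτB.1.2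
  have hgrad : ∀ t ∈ Ico 0 τ, |iteratedFDeriv ℝ 1 R (x + t • u) (fun _ => u)| ≤
      |iteratedFDeriv ℝ 1 R x (fun _ => u)| + K := by
    intro t ht
    have := (convex_Ico 0 τ).norm_image_sub_le_of_norm_hasDerivWithin_le
      (fun s hs => (hasDerivAt_iteratedFDeriv_line (k := 1) (N := 3) (by norm_num) x u s
        (h.contDiffAt (hin s hs))).hasDerivWithinAt) hess h0 ht
    simp only [Real.norm_eq_abs, zero_smul, add_zero] at this
    have h3 := mul_le_mul_of_nonneg_left (habs t ht) hK0
    have h4 := abs_sub_abs_le_abs_sub (iteratedFDeriv ℝ 1 R (x + t • u) (fun _ => u))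
      (iteratedFDeriv ℝ 1 R x (fun _ => u))
    linarith
  set K' := |iteratedFDeriv ℝ 1 R x (fun _ => u)| + K
  have hval : ∀ t ∈ Ico 0 τ, R (x + t • u) ≤ R x + K' := by
    intro t ht
    have := (convex_Ico 0 τ).norm_image_sub_le_of_norm_hasDerivWithin_le
      (fun s hs => (hasDerivAt_line (N := 3) (by norm_num) x u s
        (h.contDiffAt (hin s hs))).hasDerivWithinAt) hgrad h0 ht
    simp only [Real.norm_eq_abs, zero_smul, add_zero] at this
    have hK'0 : 0 ≤ K' := by positivity
    have h3 := mul_le_mul_of_nonneg_left (habs t ht) hK'0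
    have h4 := le_abs_self (R (x + t • u) - R x)
    linarith
  have htend : Tendsto (fun t : ℝ => x + t • u) (𝓝[<] τ) (𝓝[C] (x + τ • u)) := by
    refine tendsto_nhdsWithin_iff.2 ⟨(hline.tendsto τ).mono_left nhdsWithin_le_nhds, ?_⟩
    filter_upwards [Ioo_mem_nhdsLT hτ0] with t ht using hin t ⟨ht.1.le, ht.2⟩
  have hfr : x + τ • u ∈ frontier C := by
    rw [h.isOpen.frontier_eq]
    refine ⟨?_, hτB.2⟩
    exact mem_closure_iff_nhdsWithin_neBot.2 (htend.neBot)
  have hbig := ((h.tendsto_atTop _ hfr).comp htend).eventually_gt_atTop (R x + K')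
  obtain ⟨t, ht1, ht2⟩ := (hbig.and (Ioo_mem_nhdsLT hτ0)).exists
  exact absurd (hval t ⟨ht2.1.le, ht2.2⟩) (not_le.2 ht1)

theorem hess_smul (x u : EuclideanSpace ℝ (Fin n)) (r : ℝ) :
    iteratedFDeriv ℝ 2 R x (fun _ => r • u) = r ^ 2 * iteratedFDeriv ℝ 2 R x (fun _ => u) := by
  rw [ContinuousMultilinearMap.map_smul_univ (iteratedFDeriv ℝ 2 R x) (fun _ => r) (fun _ => u)]
  simp [smul_eq_mul]

theorem add_mem_closure (h : SelfConcordantOn C R) {x u : EuclideanSpace ℝ (Fin n)} (hx : x ∈ C)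
    (hu : iteratedFDeriv ℝ 2 R x (fun _ => u) ≤ 1) : x + u ∈ closure C := by
  have hline : Continuous fun t : ℝ => x + t • u := by fun_prop
  have htend : Tendsto (fun t : ℝ => x + t • u) (𝓝[<] 1) (𝓝 (x + u)) := by
    simpa using (hline.tendsto 1).mono_left nhdsWithin_le_nhds
  refine mem_closure_of_tendsto htend ?_
  filter_upwards [Ioo_mem_nhdsLT (zero_lt_one (α := ℝ))] with t ht
  refine h.add_mem hx ?_
  rw [hess_smul]
  have := h.hess_nonneg x hx u
  have : t ^ 2 < 1 := by nlinarith [ht.1, ht.2]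
  nlinarith [sq_nonneg t]

/-- A direction of zero curvature would put a whole line inside the Dikin ellipsoid, hence inside
the bounded set `C`. -/
theorem hess_pos (h : SelfConcordantOn C R) {x u : EuclideanSpace ℝ (Fin n)} (hx : x ∈ C)
    (hu : u ≠ 0) : 0 < iteratedFDeriv ℝ 2 R x (fun _ => u) := by
  refine (h.hess_nonneg x hx u).lt_of_ne fun h0 => ?_
  obtain ⟨B, hB⟩ := h.isBounded.exists_norm_le
  have hmem : ∀ r : ℝ, x + r • u ∈ C := fun r =>
    h.add_mem hx (by rw [hess_smul, ← h0]; norm_num)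
  have hu' : 0 < ‖u‖ := norm_pos_iff.2 hu
  set r := (2 * |B| + 1) / ‖u‖
  have h1 := hB _ (hmem r)
  have h2 := hB _ hx
  have h3 : ‖r • u‖ = 2 * |B| + 1 := by
    rw [norm_smul, Real.norm_eq_abs, abs_of_nonneg (by positivity), div_mul_cancel₀ _ hu'.ne']
  have h4 : ‖r • u‖ ≤ ‖x + r • u‖ + ‖x‖ := by
    simpa using norm_sub_le (x + r • u) x
  have := le_abs_self B
  linarith

/-- Strong monotonicity of the gradient of a self-concordant function in the local norm. -/
theorem le_grad_sub_grad (h : SelfConcordantOn C R) {x u : EuclideanSpace ℝ (Fin n)} (hx : x ∈ C)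
    (hy : x + u ∈ C) (hu : u ≠ 0) {r : ℝ} (hr : r = √(iteratedFDeriv ℝ 2 R x (fun _ => u))) :
    r - r / (1 + r) ≤
      iteratedFDeriv ℝ 1 R (x + u) (fun _ => u) - iteratedFDeriv ℝ 1 R x (fun _ => u) := by
  have hr0 : 0 < r := by rw [hr]; exact Real.sqrt_pos.2 (h.hess_pos hx hu)
  have hin : ∀ t ∈ Icc (0 : ℝ) 1, x + t • u ∈ C := fun t ht =>
    h.convex.add_smul_mem hx hy ht
  -- The Lipschitz bound gives (D²R)^{-1/2} ≤ 1/r + t, that is D²R ≥ (r/(1+rt))². An antiderivative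
  -- of the right-hand side is −r/(1+rt), so the function below is monotone.
  have hd : ∀ t ∈ Icc (0 : ℝ) 1, HasDerivAt
      (fun t : ℝ => iteratedFDeriv ℝ 1 R (x + t • u) (fun _ => u) + r / (1 + r * t))
      (iteratedFDeriv ℝ 2 R (x + t • u) (fun _ => u) - (r / (1 + r * t)) ^ 2) t := by
    intro t ht
    have hne : 1 + r * t ≠ 0 := by have := mul_nonneg hr0.le ht.1; positivity
    have h1 := hasDerivAt_iteratedFDeriv_line (k := 1) (N := 3) (by norm_num) x u t
        (h.contDiffAt (hin t ht))
    have h2 : HasDerivAt (fun t : ℝ => 1 + r * t) r t := by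
      simpa using ((hasDerivAt_id t).const_mul r).const_add 1
    have h3 := h1.add ((hasDerivAt_const t r).div h2 hne)
    refine h3.congr_deriv ?_
    rw [zero_mul, zero_sub, div_pow, neg_div, ← sq, ← sub_eq_add_neg]
  have hmono := monotoneOn_of_deriv_nonneg (convex_Icc (0 : ℝ) 1)
    (fun t ht => (hd t ht).continuousAt.continuousWithinAt)
    (fun t ht => (hd t (interior_subset ht)).differentiableAt.differentiableWithinAt)
    (fun t ht => by
      have ht := interior_subset ht
      rw [(hd t ht).deriv]
      have hp : ∀ s ∈ Icc (0 : ℝ) 1, 0 < iteratedFDeriv ℝ 2 R (x + s • u) (fun _ => u) :=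
        fun s hs => h.hess_pos (hin s hs) hu
      have key := h.abs_hess_rpow_sub_le (convex_Icc 0 1) hin le_rfl
        (fun s hs => by simpa using hp s hs) (left_mem_Icc.2 zero_le_one) ht
      simp only [zero_smul, add_zero, sub_zero, abs_of_nonneg ht.1] at key
      rw [Real.rpow_neg (hp t ht).le, Real.rpow_neg (h.hess_pos hx hu).le, ← Real.sqrt_eq_rpow,
        ← Real.sqrt_eq_rpow, ← hr] at key
      set φ := iteratedFDeriv ℝ 2 R (x + t • u) (fun _ => u)
      have hs : 0 < √φ := Real.sqrt_pos.2 (hp t ht)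
      have h1 : (√φ)⁻¹ ≤ (1 + r * t) / r := by
        have : (1 + r * t) / r = r⁻¹ + t := by field_simp
        rw [this]
        linarith [(abs_le.1 key).2]
      have h1p : 0 < 1 + r * t := by have := mul_nonneg hr0.le ht.1; positivity
      have h2 : r / (1 + r * t) ≤ √φ := by
        have := inv_anti₀ (inv_pos.2 hs) h1
        rwa [inv_inv, inv_div] at this
      have h3 : (r / (1 + r * t)) ^ 2 ≤ (√φ) ^ 2 := by gcongr
      rw [Real.sq_sqrt (hp t ht).le] at h3
      linarith)
    (left_mem_Icc.2 zero_le_one) (right_mem_Icc.2 zero_le_one) zero_le_one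
  simp only [zero_smul, add_zero, one_smul, mul_zero, mul_one, div_one] at hmono
  linarith

/-- Because `R` blows up at the frontier, a sublevel set is closed in the whole space, not only in
`C`. Being bounded, it is compact. -/
theorem exists_isMinOn (h : SelfConcordantOn C R) (hC : C.Nonempty) (c : ℝ)
    (S : EuclideanSpace ℝ (Fin n)) :
    ∃ x, x ∈ C ∧ IsMinOn (fun y => c * inner ℝ y S + R y) C x := by
  obtain ⟨x₀, hx₀⟩ := hC
  set ψ : EuclideanSpace ℝ (Fin n) → ℝ := fun y => c * inner ℝ y S + R y with hψ
  have hcont : ContinuousOn ψ C :=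
    ContinuousOn.add (by fun_prop) h.contDiffOn.continuousOn
  set K := {y | y ∈ C ∧ ψ y ≤ ψ x₀} with hK
  have hKC : K ⊆ C := fun y hy => hy.1
  have hclosed : IsClosed K := by
    refine isClosed_of_closure_subset fun y hy => ?_
    have hne : (𝓝[K] y).NeBot := mem_closure_iff_nhdsWithin_neBot.1 hy
    by_cases hyC : y ∈ C
    · refine ⟨hyC, ?_⟩
      have ht : Tendsto ψ (𝓝[K] y) (𝓝 (ψ y)) :=
        (hcont y hyC).mono_left (nhdsWithin_mono y hKC)
      exact le_of_tendsto ht (eventually_mem_nhdsWithin.mono fun z hz => hz.2)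
    · have hyf : y ∈ frontier C := by
        rw [h.isOpen.frontier_eq]; exact ⟨closure_mono hKC hy, hyC⟩
      have hlin : Tendsto (fun z => c * inner ℝ z S) (𝓝[C] y) (𝓝 (c * inner ℝ y S)) :=
        (Continuous.tendsto (by fun_prop) y).mono_left nhdsWithin_le_nhds
      have ht : Tendsto ψ (𝓝[K] y) atTop :=
        (hlin.add_atTop (h.tendsto_atTop y hyf)).mono_left (nhdsWithin_mono y hKC)
      obtain ⟨z, hz1, hz2⟩ := ((ht.eventually_gt_atTop (ψ x₀)).and
        eventually_mem_nhdsWithin).exists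
      exact absurd hz2.2 (not_le.2 hz1)
  have hcomp : IsCompact K := Metric.isCompact_of_isClosed_isBounded hclosed
    (h.isBounded.subset hKC)
  obtain ⟨x, hxK, hx⟩ := hcomp.exists_isMinOn ⟨x₀, hx₀, le_rfl⟩ (hcont.mono hKC)
  refine ⟨x, hxK.1, fun y hy => ?_⟩
  by_cases hyK : ψ y ≤ ψ x₀
  · exact hx ⟨hy, hyK⟩
  · exact hxK.2.trans (not_le.1 hyK).le

theorem argminOn_mem (h : SelfConcordantOn C R) (hC : C.Nonempty) (c : ℝ)
    (S : EuclideanSpace ℝ (Fin n)) : argminOn C (fun y => c * inner ℝ y S + R y) ∈ C :=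
  (Classical.epsilon_spec (h.exists_isMinOn hC c S)).1

theorem isMinOn_argminOn (h : SelfConcordantOn C R) (hC : C.Nonempty) (c : ℝ)
    (S : EuclideanSpace ℝ (Fin n)) : IsMinOn (fun y => c * inner ℝ y S + R y) C
      (argminOn C (fun y => c * inner ℝ y S + R y)) :=
  (Classical.epsilon_spec (h.exists_isMinOn hC c S)).2

theorem grad_eq_of_isMinOn (h : SelfConcordantOn C R) {c : ℝ} {S x : EuclideanSpace ℝ (Fin n)}
    (hx : x ∈ C) (hmin : IsMinOn (fun y => c * inner ℝ y S + R y) C x)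
    (u : EuclideanSpace ℝ (Fin n)) :
    iteratedFDeriv ℝ 1 R x (fun _ => u) = -(c * inner ℝ u S) := by
  have hx0 : x + (0 : ℝ) • u = x := by simp
  have hline : Continuous fun t : ℝ => x + t • u := by fun_prop
  have h1 := hasDerivAt_line (N := 3) (by norm_num) x u 0 (by rw [hx0]; exact h.contDiffAt hx)
  have h2 : HasDerivAt (fun t : ℝ => c * inner ℝ (x + t • u) S) (c * inner ℝ u S) 0 := by
    have : (fun t : ℝ => c * inner ℝ (x + t • u) S) =
        fun t : ℝ => c * inner ℝ x S + t * (c * inner ℝ u S) := by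
      funext t; rw [inner_add_left, real_inner_smul_left]; ring
    rw [this]
    simpa using ((hasDerivAt_id (0 : ℝ)).mul_const (c * inner ℝ u S)).const_add (c * inner ℝ x S)
  have hloc : IsLocalMin (fun t : ℝ => c * inner ℝ (x + t • u) S + R (x + t • u)) 0 := by
    have : ∀ᶠ t : ℝ in 𝓝 0, x + t • u ∈ C :=
      hline.continuousAt.eventually_mem (by rw [hx0]; exact h.isOpen.mem_nhds hx)
    filter_upwards [this] with t ht
    have := hmin ht
    simpa [hx0] using this
  have := hloc.hasDerivAt_eq_zero (h2.add h1)
  rw [hx0] at this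
  linarith

/-- Stability of the minimiser under a perturbation that is small in the dual local norm. -/
theorem inner_sub_le_of_isMinOn (h : SelfConcordantOn C R) {c δ : ℝ}
    {A B x y : EuclideanSpace ℝ (Fin n)} (hx : x ∈ C) (hy : y ∈ C)
    (hxm : IsMinOn (fun z => c * inner ℝ z A + R z) C x)
    (hym : IsMinOn (fun z => c * inner ℝ z B + R z) C y) (hδ0 : 0 ≤ δ) (hδ : δ ≤ 1 / 2)
    (hdual : ∀ w, |c * inner ℝ w (B - A)| ≤ δ * √(iteratedFDeriv ℝ 2 R x (fun _ => w))) :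
    c * inner ℝ (x - y) (B - A) ≤ 2 * δ ^ 2 := by
  by_cases hu : y - x = 0
  · rw [← neg_sub, hu]; simp; positivity
  have hyu : x + (y - x) = y := by abel
  set r := √(iteratedFDeriv ℝ 2 R x (fun _ => y - x)) with hr
  have hr0 : 0 < r := Real.sqrt_pos.2 (h.hess_pos hx hu)
  have h1 := h.le_grad_sub_grad hx (by rwa [hyu]) hu hr
  rw [hyu, h.grad_eq_of_isMinOn hx hxm, h.grad_eq_of_isMinOn hy hym] at h1
  have h2 := hdual (y - x)
  rw [← hr, inner_sub_right] at h2
  have h3 := (abs_le.1 h2).1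
  -- By the first-order conditions the gradient difference is −c⟨y−x, B−A⟩, at most δr. Strong
  -- monotonicity then gives r/(1+r) ≤ δ, and δ ≤ 1/2 turns this into r ≤ 2δ.
  have h4 : r - r / (1 + r) = r * (r / (1 + r)) := by field_simp; ring
  have h5 : r / (1 + r) ≤ δ := by
    have : r * (r / (1 + r)) ≤ r * δ := by rw [← h4]; linarith
    exact le_of_mul_le_mul_left this hr0
  rw [div_le_iff₀ (by positivity)] at h5
  have h6 : r ≤ 2 * δ := by nlinarith
  have h7 : c * inner ℝ (x - y) (B - A) ≤ δ * r := by
    rw [← neg_sub y x, inner_neg_left, inner_sub_right]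
    linarith
  nlinarith

/-- One step of optimistic follow-the-regularised-leader, with guess `M` and revealed move `z`. -/
theorem inner_le_potential_sub (h : SelfConcordantOn C R) (hC : C.Nonempty) {c δ : ℝ}
    {S M z x : EuclideanSpace ℝ (Fin n)}
    (hx : x = argminOn C (fun y => c * inner ℝ y (S + M) + R y))
    (hδ0 : 0 ≤ δ) (hδ : δ ≤ 1 / 2)
    (hdual : ∀ w, |c * inner ℝ w (z - M)| ≤ δ * √(iteratedFDeriv ℝ 2 R x (fun _ => w)))
    {Φ : EuclideanSpace ℝ (Fin n) → ℝ}
    (hΦ : ∀ S, IsLeast ((fun y => c * inner ℝ y S + R y) '' C) (Φ S)) :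
    c * inner ℝ x z - 2 * δ ^ 2 ≤ Φ (S + z) - Φ S := by
  have hxC : x ∈ C := hx ▸ h.argminOn_mem hC c _
  have hxm : IsMinOn (fun y => c * inner ℝ y (S + M) + R y) C x :=
    hx ▸ h.isMinOn_argminOn hC c (S + M)
  obtain ⟨y, hyC, hy⟩ := (hΦ (S + z)).1
  have hym : IsMinOn (fun y => c * inner ℝ y (S + z) + R y) C y := fun w hw => by
    have := (hΦ (S + z)).2 ⟨w, hw, rfl⟩
    rw [← hy] at this
    exact this
  have hBA : S + z - (S + M) = z - M := by abel
  have h1 := h.inner_sub_le_of_isMinOn hxC hyC hxm hym hδ0 hδ (by rwa [hBA])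
  have h2 : c * inner ℝ x (S + M) + R x ≤ c * inner ℝ y (S + M) + R y := hxm hyC
  have h3 := (hΦ S).2 ⟨x, hxC, rfl⟩
  rw [← hy]
  -- Testing Φ(S) at x and the optimality of x at y leaves Φ(S+z) − Φ(S) ≥ c⟨x,z⟩ − c⟨x−y, z−M⟩;
  -- stability bounds the last term.
  simp only [hBA, inner_add_right, inner_sub_right, inner_sub_left] at *
  linarith

theorem exists_potential (h : SelfConcordantOn C R) (hC : C.Nonempty) (c : ℝ) :
    ∃ Φ : EuclideanSpace ℝ (Fin n) → ℝ,
      ∀ S, IsLeast ((fun y => c * inner ℝ y S + R y) '' C) (Φ S) := by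
  refine ⟨fun S => c * inner ℝ (argminOn C (fun y => c * inner ℝ y S + R y)) S +
    R (argminOn C (fun y => c * inner ℝ y S + R y)), fun S => ⟨⟨_, h.argminOn_mem hC c S, rfl⟩, ?_⟩⟩
  rintro _ ⟨w, hw, rfl⟩
  exact h.isMinOn_argminOn hC c S hw

/-! ### Eigenbases of the Hessian -/

variable {vec : EuclideanSpace ℝ (Fin n) →
      OrthonormalBasis (Fin n) ℝ (EuclideanSpace ℝ (Fin n))}
    {val : EuclideanSpace ℝ (Fin n) → Fin n → ℝ}

theorem hess_eq_sum (hE : IsHessianEigenbasis C R vec val) {x : EuclideanSpace ℝ (Fin n)}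
    (hx : x ∈ C) (u : EuclideanSpace ℝ (Fin n)) :
    iteratedFDeriv ℝ 2 R x (fun _ => u) = ∑ i, val x i * inner ℝ (vec x i) u ^ 2 := by
  have h1 : ∀ w, iteratedFDeriv ℝ 2 R x ![w, u] = fderiv ℝ (fderiv ℝ R) x w u := fun w => by
    rw [iteratedFDeriv_two_apply]; simp
  have h2 : (fun _ : Fin 2 => u) = ![u, u] := by ext i; fin_cases i <;> rfl
  have h3 : fderiv ℝ (fderiv ℝ R) x u u =
      fderiv ℝ (fderiv ℝ R) x (∑ i, inner ℝ (vec x i) u • vec x i) u := by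
    rw [(vec x).sum_repr' u]
  rw [h2, h1, h3, map_sum, sum_apply]
  refine Finset.sum_congr rfl fun i _ => ?_
  rw [map_smul, smul_apply, ← h1, hE x hx i u, smul_eq_mul]
  ring

theorem val_pos (h : SelfConcordantOn C R) (hE : IsHessianEigenbasis C R vec val)
    {x : EuclideanSpace ℝ (Fin n)} (hx : x ∈ C) (i : Fin n) : 0 < val x i := by
  have h1 := h.hess_pos hx ((vec x).orthonormal.ne_zero i)
  have h2 : (fun _ : Fin 2 => vec x i) = ![vec x i, vec x i] := by ext i; fin_cases i <;> rfl
  rw [h2, hE x hx] at h1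
  simpa using h1

/-- In other words, λ_i^{1/2} e_i has dual local norm at most 1. This supplies the δ of the step
inequality for both estimators. -/
theorem abs_inner_le_sqrt_hess (h : SelfConcordantOn C R) (hE : IsHessianEigenbasis C R vec val)
    {x : EuclideanSpace ℝ (Fin n)} (hx : x ∈ C) (i : Fin n) (w : EuclideanSpace ℝ (Fin n)) :
    √(val x i) * |inner ℝ w (vec x i)| ≤ √(iteratedFDeriv ℝ 2 R x (fun _ => w)) := by
  apply Real.le_sqrt_of_sq_le
  rw [mul_pow, Real.sq_sqrt (h.val_pos hE hx i).le, sq_abs, hess_eq_sum hE hx, real_inner_comm]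
  exact Finset.single_le_sum
    (f := fun i => val x i * inner ℝ (vec x i) w ^ 2)
    (fun j _ => mul_nonneg (h.val_pos hE hx j).le (sq_nonneg _)) (Finset.mem_univ i)

/-- The vectors ±λ_i^{-1/2} e_i have local norm exactly 1, so the sampled point lies on the surface
of the Dikin ellipsoid and only membership in the closure is available. -/
theorem add_eigenvector_mem_closure (h : SelfConcordantOn C R)
    (hE : IsHessianEigenbasis C R vec val) {x : EuclideanSpace ℝ (Fin n)} (hx : x ∈ C) (i : Fin n)
    (b : Bool) : x + (signOf b * (√(val x i))⁻¹) • vec x i ∈ closure C := by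
  refine h.add_mem_closure hx ?_
  have h2 : (fun _ : Fin 2 => vec x i) = ![vec x i, vec x i] := by ext i; fin_cases i <;> rfl
  have hb : signOf b ^ 2 = 1 := by cases b <;> norm_num [signOf]
  rw [hess_smul, h2, hE x hx, mul_pow, hb, inv_pow, Real.sq_sqrt (h.val_pos hE hx i).le,
    real_inner_self_eq_norm_sq, (vec x).orthonormal.1 i]
  have := h.val_pos hE hx i
  field_simp
  norm_num

end SelfConcordantOn

/-! ### From the barrier hypothesis to `SelfConcordantOn`. -/

theorem ConvexOn.iteratedFDeriv_two_nonneg {E : Type*} [NormedAddCommGroup E] [NormedSpace ℝ E]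
    {C : Set E} {R : E → ℝ} (hC : IsOpen C) (hR : ConvexOn ℝ C R) (hd : ContDiffOn ℝ 3 R C)
    {x : E} (hx : x ∈ C) (u : E) : 0 ≤ iteratedFDeriv ℝ 2 R x (fun _ => u) := by
  have hline : Continuous fun t : ℝ => x + t • u := by fun_prop
  set s : Set ℝ := (fun t : ℝ => x + t • u) ⁻¹' C with hs
  have hso : IsOpen s := hC.preimage hline
  have h0 : (0 : ℝ) ∈ s := by simpa [hs] using hx
  have hg : ConvexOn ℝ s (fun t : ℝ => R (x + t • u)) := by
    have := hR.comp_affineMap (AffineMap.lineMap x (x + u) : ℝ →ᵃ[ℝ] E)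
    have he : ∀ t : ℝ, (AffineMap.lineMap x (x + u) : ℝ →ᵃ[ℝ] E) t = x + t • u := fun t => by
      rw [AffineMap.lineMap_apply]; simp [add_comm]
    have hf : (AffineMap.lineMap x (x + u) : ℝ →ᵃ[ℝ] E) = fun t : ℝ => x + t • u := funext he
    rw [hf] at this
    exact this
  have hcd : ∀ t ∈ s, ContDiffAt ℝ 3 R (x + t • u) := fun t ht =>
    hd.contDiffAt (hC.mem_nhds ht)
  have h1 : ∀ t ∈ s, HasDerivAt (fun s : ℝ => R (x + s • u))
      (iteratedFDeriv ℝ 1 R (x + t • u) (fun _ => u)) t := fun t ht =>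
    hasDerivAt_line (by norm_num) x u t (hcd t ht)
  have hmono : MonotoneOn (fun t : ℝ => iteratedFDeriv ℝ 1 R (x + t • u) (fun _ => u)) s := by
    intro a ha b hb hab
    rcases hab.lt_or_eq with hab | rfl
    · exact (hg.le_slope_of_hasDerivAt ha hb hab (h1 a ha)).trans
        (hg.slope_le_of_hasDerivAt ha hb hab (h1 b hb))
    · exact le_rfl
  have h2 := hasDerivAt_iteratedFDeriv_line (k := 1) (by norm_num) x u 0 (hcd 0 h0)
  have h3 := hmono.derivWithin_nonneg (x := 0)
  rw [derivWithin_of_isOpen hso h0, h2.deriv] at h3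
  simpa using h3

theorem IsSelfConcordantBarrier.selfConcordantOn {n : ℕ} {ϑ : ℝ}
    {F : Set (EuclideanSpace ℝ (Fin n))} {R : EuclideanSpace ℝ (Fin n) → ℝ}
    (hR : IsSelfConcordantBarrier ϑ F R) (hF : Convex ℝ F) (hc : IsCompact F) :
    SelfConcordantOn (interior F) R where
  isOpen := isOpen_interior
  convex := hF.interior
  isBounded := hc.isBounded.subset interior_subset
  contDiffOn := hR.contDiffOn
  hess_nonneg _ hx u := hR.convexOn.iteratedFDeriv_two_nonneg isOpen_interior hR.contDiffOn hx u
  third_le x hx u := by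
    have h3 : (fun _ : Fin 3 => u) = ![u, u, u] := by ext i; fin_cases i <;> rfl
    have h2 : (fun _ : Fin 2 => u) = ![u, u] := by ext i; fin_cases i <;> rfl
    rw [h3, h2]
    exact hR.third_le x hx u
  tendsto_atTop y hy := hR.tendsto_atTop y (frontier_interior_subset hy)

/-! ### The logarithmic barrier of the simplex -/

section Simplex

variable {m : ℕ}

@[simp] theorem armDist_castSucc (x : EuclideanSpace ℝ (Fin m)) (i : Fin m) :
    armDist x i.castSucc = x i := by simp [armDist]

@[simp] theorem armDist_last (x : EuclideanSpace ℝ (Fin m)) :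
    armDist x (Fin.last m) = 1 - ∑ i, x i := by simp [armDist]

theorem sum_armDist (x : EuclideanSpace ℝ (Fin m)) : ∑ k, armDist x k = 1 := by
  simp [Fin.sum_univ_castSucc]

theorem continuous_armDist (k : Fin (m + 1)) : Continuous fun x => armDist (m := m) x k := by
  refine Fin.lastCases ?_ (fun i => ?_) k
  · simp only [armDist_last]; fun_prop
  · simp only [armDist_castSucc]; fun_prop

theorem contDiff_armDist (k : Fin (m + 1)) : ContDiff ℝ 3 fun x => armDist (m := m) x k := by
  refine Fin.lastCases ?_ (fun i => ?_) k
  · simp only [armDist_last]; fun_prop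
  · simp only [armDist_castSucc]; fun_prop

/-- The linear part of `armDist`. -/
def armDir (u : EuclideanSpace ℝ (Fin m)) (k : Fin (m + 1)) : ℝ := armDist u k - armDist 0 k

theorem armDist_add_smul (x u : EuclideanSpace ℝ (Fin m)) (t : ℝ) (k : Fin (m + 1)) :
    armDist (x + t • u) k = armDist x k + t * armDir u k := by
  refine Fin.lastCases ?_ (fun i => ?_) k
  · simp [armDir, Finset.sum_add_distrib, ← Finset.mul_sum]; ring
  · simp [armDir]

theorem mem_openSimplex_iff {x : EuclideanSpace ℝ (Fin m)} :
    x ∈ openSimplex m ↔ ∀ k, 0 < armDist x k := by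
  constructor
  · rintro ⟨h1, h2⟩ k
    refine Fin.lastCases ?_ (fun i => ?_) k
    · simpa using h2
    · simpa using h1 i
  · intro h
    exact ⟨fun i => by simpa using h i.castSucc, by simpa using h (Fin.last m)⟩

/-- In barycentric coordinates all `m + 1` arms play the same role. With w_k = `armDir u k / armDist
x k` the second and third derivatives become Σ w_k² and −2 Σ w_k³. -/
theorem simplexBarrier_eq_sum (x : EuclideanSpace ℝ (Fin m)) :
    simplexBarrier m x = ∑ k, -Real.log (armDist x k) := by
  simp [simplexBarrier, Fin.sum_univ_castSucc, sub_eq_add_neg, add_comm]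

theorem isOpen_openSimplex : IsOpen (openSimplex m) := by
  have : openSimplex m = ⋂ k, {x | 0 < armDist x k} := by
    ext x; simp [mem_openSimplex_iff]
  rw [this]
  exact isOpen_iInter_of_finite fun k => isOpen_lt continuous_const (continuous_armDist k)

theorem armDist_combo (x y : EuclideanSpace ℝ (Fin m)) {a b : ℝ} (hab : a + b = 1)
    (k : Fin (m + 1)) : armDist (a • x + b • y) k = a * armDist x k + b * armDist y k := by
  refine Fin.lastCases ?_ (fun i => ?_) k
  · simp only [armDist_last, PiLp.add_apply, PiLp.smul_apply, smul_eq_mul,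
      Finset.sum_add_distrib, ← Finset.mul_sum]
    linear_combination -hab
  · simp

theorem convex_openSimplex : Convex ℝ (openSimplex m) := by
  intro x hx y hy a b ha hb hab
  rw [mem_openSimplex_iff] at *
  intro k
  rw [armDist_combo x y hab]
  rcases ha.lt_or_eq with ha | rfl
  · have := mul_pos ha (hx k)
    have := mul_nonneg hb (hy k).le
    linarith
  · have : b = 1 := by linarith
    simpa [this] using hy k

theorem armDist_le_one {x : EuclideanSpace ℝ (Fin m)} (hx : ∀ k, 0 ≤ armDist x k)
    (k : Fin (m + 1)) : armDist x k ≤ 1 := by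
  rw [← sum_armDist x]
  exact Finset.single_le_sum (fun j _ => hx j) (Finset.mem_univ k)

theorem isBounded_openSimplex : Bornology.IsBounded (openSimplex m) := by
  refine isBounded_iff_forall_norm_le.2 ⟨√m, fun x hx => ?_⟩
  rw [mem_openSimplex_iff] at hx
  rw [EuclideanSpace.norm_eq]
  apply Real.sqrt_le_sqrt
  calc ∑ i, ‖x i‖ ^ 2 ≤ ∑ _i : Fin m, (1 : ℝ) := Finset.sum_le_sum fun i _ => by
        have h0 := hx i.castSucc
        have h1 := armDist_le_one (fun k => (hx k).le) i.castSucc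
        rw [armDist_castSucc] at h0 h1
        rw [Real.norm_eq_abs, sq_abs]
        nlinarith
    _ = m := by simp

theorem simplexBarrier_nonneg {x : EuclideanSpace ℝ (Fin m)} (hx : x ∈ openSimplex m) :
    0 ≤ simplexBarrier m x := by
  rw [mem_openSimplex_iff] at hx
  rw [simplexBarrier_eq_sum]
  exact Finset.sum_nonneg fun k _ => neg_nonneg.2 <|
    Real.log_nonpos (hx k).le (armDist_le_one (fun k => (hx k).le) k)

theorem contDiffOn_simplexBarrier : ContDiffOn ℝ 3 (simplexBarrier m) (openSimplex m) := by
  have : simplexBarrier m = fun x => ∑ k, -Real.log (armDist x k) :=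
    funext simplexBarrier_eq_sum
  rw [this]
  refine ContDiffOn.sum fun k _ => ContDiffOn.neg ?_
  exact (contDiff_armDist k).contDiffOn.log fun x hx => (mem_openSimplex_iff.1 hx k).ne'

theorem eventually_mem_openSimplex {x : EuclideanSpace ℝ (Fin m)} (hx : x ∈ openSimplex m)
    (u : EuclideanSpace ℝ (Fin m)) : ∀ᶠ t : ℝ in 𝓝 0, x + t • u ∈ openSimplex m := by
  have hline : Continuous fun t : ℝ => x + t • u := by fun_prop
  exact hline.continuousAt.eventually_mem (by simpa using isOpen_openSimplex.mem_nhds hx)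

theorem hasDerivAt_armDist_line (x u : EuclideanSpace ℝ (Fin m)) (k : Fin (m + 1)) :
    HasDerivAt (fun t : ℝ => armDist (x + t • u) k) (armDir u k) 0 := by
  simp only [armDist_add_smul]
  simpa using ((hasDerivAt_id (0 : ℝ)).mul_const (armDir u k)).const_add (armDist x k)

theorem simplexBarrier_deriv_one {x : EuclideanSpace ℝ (Fin m)} (hx : x ∈ openSimplex m)
    (u : EuclideanSpace ℝ (Fin m)) : iteratedFDeriv ℝ 1 (simplexBarrier m) x (fun _ => u) =
      ∑ k, -(armDir u k / armDist x k) := by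
  have h0 : x + (0 : ℝ) • u = x := by simp
  have hc := contDiffOn_simplexBarrier.contDiffAt (isOpen_openSimplex.mem_nhds hx)
  have h1 := hasDerivAt_line (N := 3) (by norm_num) x u 0 (by rwa [h0])
  simp only [simplexBarrier_eq_sum] at h1
  have h2 : HasDerivAt (fun t : ℝ => ∑ k, -Real.log (armDist (x + t • u) k))
      (∑ k, -(armDir u k / armDist (x + (0 : ℝ) • u) k)) 0 :=
    HasDerivAt.fun_sum fun k _ => ((hasDerivAt_armDist_line x u k).log
      (by rw [h0]; exact (mem_openSimplex_iff.1 hx k).ne')).neg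
  simpa [h0] using h1.unique h2

theorem simplexBarrier_deriv_two {x : EuclideanSpace ℝ (Fin m)} (hx : x ∈ openSimplex m)
    (u : EuclideanSpace ℝ (Fin m)) : iteratedFDeriv ℝ 2 (simplexBarrier m) x (fun _ => u) =
      ∑ k, (armDir u k / armDist x k) ^ 2 := by
  have h0 : x + (0 : ℝ) • u = x := by simp
  have hc := contDiffOn_simplexBarrier.contDiffAt (isOpen_openSimplex.mem_nhds hx)
  have h1 := hasDerivAt_iteratedFDeriv_line (k := 1) (N := 3) (by norm_num) x u 0 (by rwa [h0])
  have h2 : HasDerivAt (fun t : ℝ => ∑ k, -(armDir u k / armDist (x + t • u) k))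
      (∑ k, (armDir u k / armDist x k) ^ 2) 0 := by
    refine HasDerivAt.fun_sum fun k _ => ?_
    have hne : armDist (x + (0 : ℝ) • u) k ≠ 0 := by
      rw [h0]; exact (mem_openSimplex_iff.1 hx k).ne'
    refine (((hasDerivAt_const (0 : ℝ) (armDir u k)).div
      (hasDerivAt_armDist_line x u k) hne).neg).congr_deriv ?_
    rw [h0] at hne ⊢
    field_simp
    ring
  have h3 := h2.congr_of_eventuallyEq
    ((eventually_mem_openSimplex hx u).mono fun t ht => simplexBarrier_deriv_one ht u)
  simpa [h0] using h1.unique h3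

theorem simplexBarrier_deriv_three {x : EuclideanSpace ℝ (Fin m)} (hx : x ∈ openSimplex m)
    (u : EuclideanSpace ℝ (Fin m)) : iteratedFDeriv ℝ 3 (simplexBarrier m) x (fun _ => u) =
      ∑ k, -2 * (armDir u k / armDist x k) ^ 3 := by
  have h0 : x + (0 : ℝ) • u = x := by simp
  have hc := contDiffOn_simplexBarrier.contDiffAt (isOpen_openSimplex.mem_nhds hx)
  have h1 := hasDerivAt_iteratedFDeriv_line (k := 2) (N := 3) (by norm_num) x u 0 (by rwa [h0])
  have h2 : HasDerivAt (fun t : ℝ => ∑ k, (armDir u k / armDist (x + t • u) k) ^ 2)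
      (∑ k, -2 * (armDir u k / armDist x k) ^ 3) 0 := by
    refine HasDerivAt.fun_sum fun k _ => ?_
    have hne : armDist (x + (0 : ℝ) • u) k ≠ 0 := by
      rw [h0]; exact (mem_openSimplex_iff.1 hx k).ne'
    refine (((hasDerivAt_const (0 : ℝ) (armDir u k)).div
      (hasDerivAt_armDist_line x u k) hne).pow 2).congr_deriv ?_
    simp only [Pi.div_apply]
    rw [h0] at hne ⊢
    field_simp
    ring_nf
    field_simp
  have h3 := h2.congr_of_eventuallyEq
    ((eventually_mem_openSimplex hx u).mono fun t ht => simplexBarrier_deriv_two ht u)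
  simpa [h0] using h1.unique h3

/-- Each |w_k| is at most the ℓ² norm, so one factor can be pulled out of the cubes. This is the
self-concordance inequality of the logarithmic barrier. -/
theorem abs_sum_pow_three_le {ι : Type*} [Fintype ι] (w : ι → ℝ) :
    |∑ k, w k ^ 3| ≤ (∑ k, w k ^ 2) ^ (3 / 2 : ℝ) := by
  have hs : 0 ≤ ∑ k, w k ^ 2 := Finset.sum_nonneg fun k _ => sq_nonneg _
  have h1 : (∑ k, w k ^ 2) ^ (3 / 2 : ℝ) = (∑ k, w k ^ 2) * √(∑ k, w k ^ 2) := by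
    rw [show (3 / 2 : ℝ) = 1 + 1 / 2 by norm_num, Real.rpow_add' hs (by norm_num), Real.rpow_one,
      Real.sqrt_eq_rpow]
  rw [h1, Finset.sum_mul]
  refine (Finset.abs_sum_le_sum_abs _ _).trans (Finset.sum_le_sum fun k _ => ?_)
  have h2 : |w k| ≤ √(∑ k, w k ^ 2) := Real.abs_le_sqrt
    (Finset.single_le_sum (f := fun k => w k ^ 2) (fun j _ => sq_nonneg _) (Finset.mem_univ k))
  rw [pow_succ, abs_mul, abs_of_nonneg (sq_nonneg (w k))]
  gcongr

/-- At a frontier point some barycentric coordinate vanishes; its term diverges while all other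
terms stay nonnegative. -/
theorem tendsto_simplexBarrier {y : EuclideanSpace ℝ (Fin m)} (hy : y ∈ frontier (openSimplex m)) :
    Tendsto (simplexBarrier m) (𝓝[openSimplex m] y) atTop := by
  rw [isOpen_openSimplex.frontier_eq] at hy
  have hnn : ∀ k, 0 ≤ armDist y k := fun k =>
    closure_minimal (s := openSimplex m) (t := {x | 0 ≤ armDist x k})
      (fun x hx => (mem_openSimplex_iff.1 hx k).le)
      (isClosed_le continuous_const (continuous_armDist k)) hy.1
  obtain ⟨k, hk⟩ : ∃ k, armDist y k = 0 := by
    by_contra! hcon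
    exact hy.2 (mem_openSimplex_iff.2 fun k => (hnn k).lt_of_ne (hcon k).symm)
  have h1 : Tendsto (fun x => armDist x k) (𝓝[openSimplex m] y) (𝓝[>] 0) := by
    refine tendsto_nhdsWithin_iff.2 ⟨?_, eventually_mem_nhdsWithin.mono fun x hx =>
      mem_openSimplex_iff.1 hx k⟩
    rw [← hk]
    exact ((continuous_armDist k).tendsto y).mono_left nhdsWithin_le_nhds
  have h2 := tendsto_neg_atBot_atTop.comp (Real.tendsto_log_nhdsGT_zero.comp h1)
  refine tendsto_atTop_mono' _ (eventually_mem_nhdsWithin.mono fun x hx => ?_) h2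
  rw [simplexBarrier_eq_sum]
  have hx := mem_openSimplex_iff.1 hx
  exact Finset.single_le_sum (f := fun k => -Real.log (armDist x k)) (fun j _ => neg_nonneg.2 <|
    Real.log_nonpos (hx j).le (armDist_le_one (fun k => (hx k).le) j)) (Finset.mem_univ k)

theorem selfConcordantOn_simplexBarrier :
    SelfConcordantOn (openSimplex m) (simplexBarrier m) where
  isOpen := isOpen_openSimplex
  convex := convex_openSimplex
  isBounded := isBounded_openSimplex
  contDiffOn := contDiffOn_simplexBarrier
  hess_nonneg x hx u := by
    rw [simplexBarrier_deriv_two hx]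
    exact Finset.sum_nonneg fun k _ => sq_nonneg _
  third_le x hx u := by
    rw [simplexBarrier_deriv_two hx, simplexBarrier_deriv_three hx, ← Finset.mul_sum, abs_mul]
    norm_num
    exact abs_sum_pow_three_le _
  tendsto_atTop y hy := tendsto_simplexBarrier hy

/-- A vertex of the simplex, moved towards the barycentre by the weight `α`. -/
def mixedVertex (k : Fin (m + 1)) (α : ℝ) : EuclideanSpace ℝ (Fin m) :=
  WithLp.toLp 2 fun i => (if i.castSucc = k then 1 - α else 0) + α / (m + 1)

theorem armDist_mixedVertex (k j : Fin (m + 1)) (α : ℝ) :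
    armDist (mixedVertex k α) j = (if j = k then 1 - α else 0) + α / (m + 1) := by
  have hcast : ∀ i : Fin m, armDist (mixedVertex k α) i.castSucc =
      (if i.castSucc = k then 1 - α else 0) + α / (m + 1) := fun i => by simp [mixedVertex]
  refine Fin.lastCases ?_ hcast j
  have h1 := sum_armDist (mixedVertex k α)
  rw [Fin.sum_univ_castSucc, Finset.sum_congr rfl fun i _ => hcast i] at h1
  have h2 : ∑ j : Fin (m + 1), ((if j = k then 1 - α else 0) + α / ((m : ℝ) + 1)) = 1 := by
    rw [Finset.sum_add_distrib, Finset.sum_ite_eq']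
    simp
    field_simp
    ring
  rw [Fin.sum_univ_castSucc] at h2
  linarith

theorem mixedVertex_mem {k : Fin (m + 1)} {α : ℝ} (h0 : 0 < α) (h1 : α ≤ 1) :
    mixedVertex k α ∈ openSimplex m := by
  refine mem_openSimplex_iff.2 fun j => ?_
  rw [armDist_mixedVertex]
  have : 0 < α / ((m : ℝ) + 1) := by positivity
  split_ifs <;> linarith

/-- Every barycentric coordinate is at least α/(m+1). -/
theorem simplexBarrier_mixedVertex_le {k : Fin (m + 1)} {α : ℝ} (h0 : 0 < α) (h1 : α ≤ 1) :
    simplexBarrier m (mixedVertex k α) ≤ (m + 1) * Real.log ((m + 1) / α) := by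
  rw [simplexBarrier_eq_sum]
  have hp : 0 < α / ((m : ℝ) + 1) := by positivity
  calc ∑ j, -Real.log (armDist (mixedVertex k α) j)
      ≤ ∑ _j : Fin (m + 1), Real.log ((m + 1) / α) := Finset.sum_le_sum fun j _ => by
        rw [← inv_div, Real.log_inv, armDist_mixedVertex]
        refine neg_le_neg (Real.log_le_log hp ?_)
        split_ifs <;> linarith
    _ = (m + 1) * Real.log ((m + 1) / α) := by simp

end Simplex

end

noncomputable section

/-! ### Sampling an eigenvector and a sign -/

theorem abs_signOf (b : Bool) : |signOf b| = 1 := by cases b <;> norm_num [signOf]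

section Sampling

variable {n : ℕ} (e : OrthonormalBasis (Fin n) ℝ (EuclideanSpace ℝ (Fin n))) {σ : Fin n → ℝ}

/-- The signs cancel in pairs, so the perturbed point has mean `h` under any affine function; 2n
counts the draws. -/
theorem sum_inner_perturb (h a : EuclideanSpace ℝ (Fin n)) (c : ℝ) :
    ∑ ib : Fin n × Bool, (c + inner ℝ (h + (signOf ib.2 * (σ ib.1)⁻¹) • e ib.1) a) =
      2 * n * (c + inner ℝ h a) := by
  rw [Fintype.sum_prod_type]
  have : ∀ i : Fin n, ∑ b : Bool, (c + inner ℝ (h + (signOf b * (σ i)⁻¹) • e i) a) =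
      2 * (c + inner ℝ h a) := fun i => by
    simp only [Fintype.sum_bool, signOf, inner_add_left, real_inner_smul_left]
    norm_num
    ring
  rw [Finset.sum_congr rfl fun i _ => this i]
  simp
  ring

/-- This is unbiasedness of the one-point estimate. The sign kills `c` and ⟨h,a⟩; in the remaining
term σ cancels and Parseval's identity recovers ⟨w,a⟩. -/
theorem sum_inner_perturb_mul (hσ : ∀ i, σ i ≠ 0) (h a w : EuclideanSpace ℝ (Fin n)) (c : ℝ) :
    ∑ ib : Fin n × Bool, (c + inner ℝ (h + (signOf ib.2 * (σ ib.1)⁻¹) • e ib.1) a) *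
      (signOf ib.2 * σ ib.1 * inner ℝ w (e ib.1)) = 2 * inner ℝ w a := by
  rw [Fintype.sum_prod_type, ← e.sum_inner_mul_inner w a, Finset.mul_sum]
  refine Finset.sum_congr rfl fun i _ => ?_
  simp only [Fintype.sum_bool, signOf, inner_add_left, real_inner_smul_left]
  have := hσ i
  field_simp
  norm_num
  ring

end Sampling

/-! ### Sums over the rounds -/

section Cumulative

variable {n m : ℕ} (φ ψ : List (Draw n m) → Draw n m → ℝ)

theorem cumulative_add (run : List (Draw n m)) :
    cumulative (fun past c => φ past c + ψ past c) run = cumulative φ run + cumulative ψ run := by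
  induction run with
  | nil => simp [cumulative]
  | cons c past ih => simp only [cumulative, ih]; ring

theorem cumulative_mul_left (a : ℝ) (run : List (Draw n m)) :
    cumulative (fun past c => a * φ past c) run = a * cumulative φ run := by
  induction run with
  | nil => simp [cumulative]
  | cons c past ih => simp only [cumulative, ih]; ring

theorem cumulative_sub (run : List (Draw n m)) :
    cumulative (fun past c => φ past c - ψ past c) run = cumulative φ run - cumulative ψ run := by
  induction run with
  | nil => simp [cumulative]
  | cons c past ih => simp only [cumulative, ih]; ring

theorem cumulative_const (a : ℝ) (run : List (Draw n m)) :
    cumulative (fun _ _ => a) run = run.length * a := by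
  induction run with
  | nil => simp [cumulative]
  | cons c past ih => simp only [cumulative, ih, List.length_cons]; push_cast; ring

variable {φ ψ}

theorem cumulative_le_cumulative {run : List (Draw n m)}
    (h : ∀ past c, past.length < run.length → φ past c ≤ ψ past c) :
    cumulative φ run ≤ cumulative ψ run := by
  induction run with
  | nil => simp [cumulative]
  | cons c past ih =>
    exact add_le_add (ih fun p c hp => h p c (hp.trans (by simp))) (h past c (by simp))

/-- A quantity that grows in every round by at least `φ` dominates the sum of `φ`. -/
theorem cumulative_le_of_step {G : List (Draw n m) → ℝ} {run : List (Draw n m)}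
    (h : ∀ past c, past.length < run.length → φ past c ≤ G (c :: past) - G past) :
    cumulative φ run ≤ G run - G [] := by
  induction run with
  | nil => simp [cumulative]
  | cons c past ih =>
    have h1 := ih fun p c hp => h p c (hp.trans (by simp))
    have h2 := h past c (by simp)
    simp only [cumulative]
    linarith

end Cumulative

namespace Learner

variable {n m : ℕ} (L : Learner n m) (N : Environment n m)

/-! ### The expectation over the draws of the learner -/

/-- The conditional expectation of a function of the draws of one round, given the history. -/
def drawExpect (past : List (Draw n m)) (f : Draw n m → ℝ) : ℝ :=
  ∑ c, L.drawProb N past c * f c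

/-- The draws of the learner have a probability distribution in every round. -/
def ProperDraws : Prop :=
  ∀ past, (∀ c, 0 ≤ L.drawProb N past c) ∧ ∑ c, L.drawProb N past c = 1

theorem expect_succ (T : ℕ) (g : List (Draw n m) → ℝ) :
    L.expect N (T + 1) g = L.expect N T fun past => L.drawExpect N past fun c => g (c :: past) :=
  rfl

theorem expect_add (T : ℕ) (g g' : List (Draw n m) → ℝ) :
    L.expect N T (fun run => g run + g' run) = L.expect N T g + L.expect N T g' := by
  induction T generalizing g g' with
  | zero => rfl
  | succ T ih =>
    simp only [expect_succ, ← ih, drawExpect, mul_add, Finset.sum_add_distrib]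

theorem expect_mul_left (T : ℕ) (a : ℝ) (g : List (Draw n m) → ℝ) :
    L.expect N T (fun run => a * g run) = a * L.expect N T g := by
  induction T generalizing g with
  | zero => rfl
  | succ T ih =>
    simp only [expect_succ, ← ih, drawExpect, Finset.mul_sum, mul_left_comm]

variable {L N}

theorem expect_mono (hp : L.ProperDraws N) {T : ℕ} {g g' : List (Draw n m) → ℝ}
    (h : ∀ run, run.length = T → g run ≤ g' run) : L.expect N T g ≤ L.expect N T g' := by
  induction T generalizing g g' with
  | zero => exact h [] rfl
  | succ T ih =>
    exact ih fun past hpast => Finset.sum_le_sum fun c _ =>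
      mul_le_mul_of_nonneg_left (h _ (by simp [hpast])) ((hp past).1 c)

theorem drawExpect_const (hp : L.ProperDraws N) (past : List (Draw n m)) (a : ℝ) :
    L.drawExpect N past (fun _ => a) = a := by
  rw [drawExpect, ← Finset.sum_mul, (hp past).2, one_mul]

theorem expect_const (hp : L.ProperDraws N) (T : ℕ) (a : ℝ) :
    L.expect N T (fun _ => a) = a := by
  induction T with
  | zero => rfl
  | succ T ih => simp only [expect_succ, drawExpect_const hp, ih]

theorem expect_cumulative_succ (hp : L.ProperDraws N) (T : ℕ)
    (φ : List (Draw n m) → Draw n m → ℝ) :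
    L.expect N (T + 1) (cumulative φ) =
      L.expect N T (cumulative φ) + L.expect N T fun past => L.drawExpect N past (φ past) := by
  rw [expect_succ, ← expect_add]
  congr 1
  funext past
  simp only [cumulative, drawExpect, mul_add, Finset.sum_add_distrib]
  rw [← Finset.sum_mul, (hp past).2, one_mul]

/-- By the tower property it suffices to compare summands in conditional expectation given the past,
which is how estimates are exchanged for true losses. -/
theorem expect_cumulative_mono (hp : L.ProperDraws N) {T : ℕ}
    {φ ψ : List (Draw n m) → Draw n m → ℝ}
    (h : ∀ past, L.drawExpect N past (φ past) ≤ L.drawExpect N past (ψ past)) :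
    L.expect N T (cumulative φ) ≤ L.expect N T (cumulative ψ) := by
  induction T with
  | zero => rfl
  | succ T ih =>
    rw [expect_cumulative_succ hp, expect_cumulative_succ hp]
    exact add_le_add ih (expect_mono hp fun past _ => h past)

theorem expect_cumulative_congr (hp : L.ProperDraws N) {T : ℕ}
    {φ ψ : List (Draw n m) → Draw n m → ℝ}
    (h : ∀ past, L.drawExpect N past (φ past) = L.drawExpect N past (ψ past)) :
    L.expect N T (cumulative φ) = L.expect N T (cumulative ψ) :=
  (expect_cumulative_mono hp fun past => (h past).le).antisymm
    (expect_cumulative_mono hp fun past => (h past).ge)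

theorem abs_expect_le (hp : L.ProperDraws N) {T : ℕ} {g : List (Draw n m) → ℝ} {B : ℝ}
    (h : ∀ run, run.length = T → |g run| ≤ B) : |L.expect N T g| ≤ B := by
  rw [abs_le]
  constructor
  · rw [← expect_const hp T (-B)]
    exact expect_mono hp fun run hr => (abs_le.1 (h run hr)).1
  · rw [← expect_const hp T B]
    exact expect_mono hp fun run hr => (abs_le.1 (h run hr)).2

variable (L N)

theorem drawExpect_eq (past : List (Draw n m)) (f : Draw n m → ℝ) :
    L.drawExpect N past f = ∑ jb : Fin (max 1 m) × Bool, ((max 1 m : ℕ) : ℝ)⁻¹ * (1 / 2) *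
      ∑ k, L.modelDist N past jb.1 jb.2 k *
        ∑ ib : Fin n × Bool, (n : ℝ)⁻¹ * (1 / 2) * f (jb, k, ib) := by
  rw [drawExpect, Fintype.sum_prod_type]
  refine Finset.sum_congr rfl fun jb _ => ?_
  rw [Fintype.sum_prod_type, Finset.mul_sum]
  refine Finset.sum_congr rfl fun k _ => ?_
  rw [Finset.mul_sum, Finset.mul_sum]
  refine Finset.sum_congr rfl fun ib _ => ?_
  simp only [drawProb, Draw.model]
  ring

/-! ### Standing assumptions -/

/-- The assumptions on the inputs of the learner. -/
structure Regular : Prop where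
  dim_pos : 0 < n
  barrier : SelfConcordantOn (interior L.F) L.R
  nonempty : (interior L.F).Nonempty
  subset_ball : closure (interior L.F) ⊆ Metric.closedBall 0 1
  nonneg : ∀ x ∈ interior L.F, 0 ≤ L.R x
  η_pos : 0 < L.η
  eigen : IsHessianEigenbasis (interior L.F) L.R L.vec L.val
  armEigen : IsHessianEigenbasis (openSimplex m) (simplexBarrier m) L.armVec L.armVal

/-- Moves and predictions lie in the unit ball, and the first predictions vanish. -/
structure _root_.Environment.Bounded : Prop where
  move_le : ∀ past, ‖N.move past‖ ≤ 1
  pred_le : ∀ k past, ‖N.pred k past‖ ≤ 1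
  pred_first : ∀ k, N.pred k [] = 0

variable {L N}

theorem openSimplex_nonempty (m : ℕ) : (openSimplex m).Nonempty :=
  ⟨_, mixedVertex_mem (k := Fin.last m) zero_lt_one le_rfl⟩

theorem armLeader_mem (S : EuclideanSpace ℝ (Fin m)) : armLeader S ∈ openSimplex m :=
  selfConcordantOn_simplexBarrier.argminOn_mem (openSimplex_nonempty m) _ S

theorem Regular.leader_mem (hL : L.Regular) (S : EuclideanSpace ℝ (Fin n)) :
    L.leader S ∈ interior L.F :=
  hL.barrier.argminOn_mem hL.nonempty L.η S

theorem Regular.center_mem (hL : L.Regular) (past : List (Draw n m)) (k : Fin (m + 1)) :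
    L.center N past k ∈ interior L.F := hL.leader_mem _

theorem Regular.norm_decision_le (hL : L.Regular) (past : List (Draw n m)) (c : Draw n m) :
    ‖L.decision N past c‖ ≤ 1 := by
  have := hL.subset_ball (hL.barrier.add_eigenvector_mem_closure hL.eigen
    (hL.center_mem (N := N) past c.model) c.2.2.1 c.2.2.2)
  rw [decision, perturb]
  simpa using this

/-- The perturbed point stays in the closed simplex because the closed Dikin ellipsoid does; this
makes q_t a genuine distribution. -/
theorem Regular.modelDist_nonneg (hL : L.Regular) (past : List (Draw n m)) (j : Fin (max 1 m))
    (b : Bool) (k : Fin (m + 1)) : 0 ≤ L.modelDist N past j b k := by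
  have hcl : ∀ f ∈ closure (openSimplex m), 0 ≤ armDist f k := fun f hf =>
    closure_minimal (s := openSimplex m) (t := {x | 0 ≤ armDist x k})
      (fun x hx => (mem_openSimplex_iff.1 hx k).le)
      (isClosed_le continuous_const (continuous_armDist k)) hf
  refine hcl _ ?_
  rw [armPerturb]
  split_ifs with hj
  · exact selfConcordantOn_simplexBarrier.add_eigenvector_mem_closure hL.armEigen
      (armLeader_mem _) _ _
  · exact subset_closure (armLeader_mem _)

theorem Regular.properDraws (hL : L.Regular) : L.ProperDraws N := by
  refine fun past => ⟨fun c => ?_, ?_⟩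
  · have := hL.modelDist_nonneg (N := N) past c.1.1 c.1.2 c.model
    unfold drawProb
    positivity
  · have h1 := L.drawExpect_eq N past fun _ => 1
    simp only [drawExpect, mul_one] at h1
    rw [h1]
    have hn : (n : ℝ) ≠ 0 := by exact_mod_cast hL.dim_pos.ne'
    have hm : ((max 1 m : ℕ) : ℝ) ≠ 0 := by positivity
    have h2 : ∑ _ib : Fin n × Bool, (n : ℝ)⁻¹ * (1 / 2) = 1 := by
      simp
      field_simp
    have h3 : ∀ jb : Fin (max 1 m) × Bool, ∑ k, L.modelDist N past jb.1 jb.2 k = 1 :=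
      fun jb => sum_armDist _
    simp only [h2, mul_one, h3]
    rw [Finset.sum_const, Finset.card_univ, Fintype.card_prod, Fintype.card_fin, Fintype.card_bool,
      nsmul_eq_mul]
    push_cast at hm ⊢
    field_simp

/-! ### The regret of the decisions -/

variable (L N) in
/-- The estimate of Nature's move. -/
def roundEstimate (past : List (Draw n m)) (c : Draw n m) : EuclideanSpace ℝ (Fin n) :=
  L.estimate (L.center N past c.model) c.2.2.1 c.2.2.2
    (inner ℝ (L.decision N past c) (N.move past)) (N.pred c.model past)

theorem estSum_cons (past : List (Draw n m)) (c : Draw n m) :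
    L.estSum N (c :: past) = L.estSum N past + L.roundEstimate N past c := rfl

theorem inner_estSum (w : EuclideanSpace ℝ (Fin n)) (run : List (Draw n m)) :
    inner ℝ w (L.estSum N run) = cumulative (fun past c => inner ℝ w (L.roundEstimate N past c))
      run := by
  induction run with
  | nil => simp [cumulative, estSum]
  | cons c past ih => rw [estSum_cons, inner_add_right, ih]; rfl

/-- The first round uses no guess, which is consistent because the first predictions vanish. -/
theorem guess_eq (hN : N.Bounded) (past : List (Draw n m)) (k : Fin (m + 1)) :
    guess N past k = N.pred k past := by
  cases past with
  | nil => exact (hN.pred_first k).symm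
  | cons c past => rfl

theorem inner_roundEstimate (w : EuclideanSpace ℝ (Fin n)) (past : List (Draw n m))
    (c : Draw n m) : inner ℝ w (L.roundEstimate N past c) =
      n * L.gap N past c * (signOf c.2.2.2 * √(L.val (L.center N past c.model) c.2.2.1) *
        inner ℝ w (L.vec (L.center N past c.model) c.2.2.1)) + inner ℝ w (N.pred c.model past) := by
  rw [roundEstimate, estimate, inner_add_right, real_inner_smul_right, gap, decision]
  ring

/-- The regret against the estimated moves is bounded on every history, by telescoping the potential
with δ = η n |gap|. -/
theorem Regular.cumulative_inner_le (hL : L.Regular) (hN : N.Bounded) {run : List (Draw n m)}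
    (hstep : ∀ past c, past.length < run.length → L.η * (n * |L.gap N past c|) < 1 / 4)
    {w : EuclideanSpace ℝ (Fin n)} (hw : w ∈ interior L.F) :
    cumulative (fun past c => L.η * inner ℝ (L.center N past c.model - w)
        (L.roundEstimate N past c)) run ≤
      L.R w + 2 * L.η ^ 2 * n ^ 2 * cumulative (fun past c => L.gap N past c ^ 2) run := by
  obtain ⟨Φ, hΦ⟩ := hL.barrier.exists_potential hL.nonempty L.η
  have h1 := cumulative_le_of_step (run := run) (G := fun p => Φ (L.estSum N p))
    (φ := fun past c => L.η * inner ℝ (L.center N past c.model) (L.roundEstimate N past c) -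
      2 * (L.η * (n * |L.gap N past c|)) ^ 2) (fun past c hp => by
    refine hL.barrier.inner_le_potential_sub hL.nonempty (M := guess N past c.model)
      (x := L.center N past c.model) rfl
      (mul_nonneg hL.η_pos.le (by positivity)) ((hstep past c hp).le.trans (by norm_num))
      (fun v => ?_) hΦ
    have h2 := hL.barrier.abs_inner_le_sqrt_hess hL.eigen (hL.center_mem (N := N) past c.model)
      c.2.2.1 v
    rw [inner_sub_right, guess_eq hN, inner_roundEstimate, add_sub_cancel_right]
    simp only [abs_mul, abs_signOf, one_mul, abs_of_pos hL.η_pos, Nat.abs_cast,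
      abs_of_nonneg (Real.sqrt_nonneg _)]
    rw [← mul_assoc]
    exact mul_le_mul_of_nonneg_left h2 (mul_nonneg hL.η_pos.le (by positivity)))
  have h3 : Φ (L.estSum N run) ≤ L.η * inner ℝ w (L.estSum N run) + L.R w :=
    (hΦ _).2 ⟨w, hw, rfl⟩
  have h4 : 0 ≤ Φ (L.estSum N []) := by
    obtain ⟨y, hy, hy'⟩ := (hΦ (L.estSum N [])).1
    rw [← hy']
    simpa [estSum] using hL.nonneg y hy
  rw [inner_estSum] at h3
  simp only [cumulative_sub, cumulative_mul_left, inner_sub_left, mul_pow, sq_abs] at h1 ⊢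
  linarith

/-- The centre depends on the drawn model, so the averaging over index and sign takes place inside
the sum over models. There both sides equal ⟨h − w, x_t⟩. -/
theorem Regular.drawExpect_inner_roundEstimate (hL : L.Regular) (past : List (Draw n m))
    (w : EuclideanSpace ℝ (Fin n)) :
    L.drawExpect N past (fun c => inner ℝ (L.center N past c.model - w)
        (L.roundEstimate N past c)) =
      L.drawExpect N past (fun c => inner ℝ (L.decision N past c) (N.move past) -
        inner ℝ w (N.move past)) := by
  have hn : (n : ℝ) ≠ 0 := by exact_mod_cast hL.dim_pos.ne'
  rw [drawExpect_eq, drawExpect_eq]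
  refine Finset.sum_congr rfl fun jb _ => ?_
  congr 1
  refine Finset.sum_congr rfl fun k _ => ?_
  congr 1
  set h := L.center N past k with hh
  have hσ : ∀ i, √(L.val h i) ≠ 0 := fun i =>
    (Real.sqrt_pos.2 (hL.barrier.val_pos hL.eigen (hL.center_mem (N := N) past k) i)).ne'
  have h1 := sum_inner_perturb_mul (L.vec h) hσ h (N.move past - N.pred k past) (h - w) 0
  have h2 := sum_inner_perturb (σ := fun i => √(L.val h i)) (L.vec h) h (N.move past)
    (-inner ℝ w (N.move past))
  have h3 : ∑ _ib : Fin n × Bool, inner ℝ (h - w) (N.pred k past) =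
      2 * n * inner ℝ (h - w) (N.pred k past) := by
    simp only [Finset.sum_const, Finset.card_univ, Fintype.card_prod, Fintype.card_fin,
      Fintype.card_bool, nsmul_eq_mul]
    push_cast
    ring
  rw [← Finset.mul_sum, ← Finset.mul_sum]
  have h4 : ∑ ib : Fin n × Bool, inner ℝ (h - w) (L.roundEstimate N past (jb, k, ib)) =
      n * (2 * inner ℝ (h - w) (N.move past - N.pred k past)) +
        2 * n * inner ℝ (h - w) (N.pred k past) := by
    rw [← h1, ← h3, Finset.mul_sum, ← Finset.sum_add_distrib]
    refine Finset.sum_congr rfl fun ib _ => ?_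
    rw [inner_roundEstimate, zero_add, inner_sub_right]
    simp only [gap, decision, perturb, Draw.model, ← hh]
    ring
  have h5 : ∑ ib : Fin n × Bool, (inner ℝ (L.decision N past (jb, k, ib)) (N.move past) -
      inner ℝ w (N.move past)) = 2 * n * inner ℝ (h - w) (N.move past) := by
    rw [inner_sub_left, sub_eq_neg_add, ← h2]
    refine Finset.sum_congr rfl fun ib _ => ?_
    rw [sub_eq_neg_add]
    rfl
  rw [h4, h5, inner_sub_right]
  ring

/-- The regret bound for a fixed environment. -/
theorem Regular.expect_regret_le (hL : L.Regular) (hN : N.Bounded) {T : ℕ}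
    (hstep : ∀ past c, past.length < T → L.η * (n * |L.gap N past c|) < 1 / 4)
    {w : EuclideanSpace ℝ (Fin n)} (hw : w ∈ interior L.F) :
    L.expect N T (cumulative fun past c =>
        inner ℝ (L.decision N past c) (N.move past) - inner ℝ w (N.move past)) ≤
      L.η⁻¹ * L.R w + 2 * L.η * n ^ 2 *
        L.expect N T (cumulative fun past c => L.gap N past c ^ 2) := by
  have hp : L.ProperDraws N := hL.properDraws
  have h1 := expect_mono hp (T := T) fun run hr =>
    hL.cumulative_inner_le hN (run := run) (by rwa [hr]) hw
  rw [expect_add, expect_const hp, expect_mul_left] at h1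
  simp only [cumulative_mul_left] at h1
  rw [expect_mul_left, expect_cumulative_congr hp
    (fun past => hL.drawExpect_inner_roundEstimate past w)] at h1
  have hη := hL.η_pos
  refine le_of_mul_le_mul_left (h1.trans_eq ?_) hη
  field_simp

/-! ### The regret of the bandit algorithm over the models -/

variable (L N)

/-- The conditional expected loss of the model `k` in the round after `past`. -/
def modelLoss (past : List (Draw n m)) (k : Fin (m + 1)) : ℝ :=
  ∑ ib : Fin n × Bool, (n : ℝ)⁻¹ * (1 / 2) *
    (L.gap N past ((⟨0, by simp⟩, true), k, ib)) ^ 2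

/-- The expected loss if the model is drawn from the distribution `armDist f`. -/
def mixedLoss (past : List (Draw n m)) (f : EuclideanSpace ℝ (Fin m)) : ℝ :=
  ∑ k, armDist f k * L.modelLoss N past k

/-- The gradient of `mixedLoss`. -/
def lossVec (past : List (Draw n m)) : EuclideanSpace ℝ (Fin m) :=
  WithLp.toLp 2 fun i => L.modelLoss N past i.castSucc - L.modelLoss N past (Fin.last m)

/-- Eliminating the last arm makes the loss affine in `f`, the form required by the sampling
identities; their `c` is the last arm's loss. -/
theorem mixedLoss_eq (past : List (Draw n m)) (f : EuclideanSpace ℝ (Fin m)) :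
    L.mixedLoss N past f =
      L.modelLoss N past (Fin.last m) + inner ℝ f (L.lossVec N past) := by
  simp only [mixedLoss, Fin.sum_univ_castSucc, armDist_castSucc, armDist_last, lossVec,
    PiLp.inner_apply, RCLike.inner_apply, conj_trivial, sub_mul, Finset.sum_sub_distrib,
    ← Finset.mul_sum, mul_comm]
  ring

/-- The bandit algorithm's estimate of the loss vector. -/
def roundArmEstimate (past : List (Draw n m)) (c : Draw n m) : EuclideanSpace ℝ (Fin m) :=
  L.armEstimate (armLeader (L.armEstSum N past)) c.1.1 c.1.2 ((L.gap N past c) ^ 2)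

theorem expect_cumulative_mul_left (T : ℕ) (a : ℝ) (φ : List (Draw n m) → Draw n m → ℝ) :
    L.expect N T (cumulative fun past c => a * φ past c) = a * L.expect N T (cumulative φ) := by
  rw [← expect_mul_left]
  exact congrArg _ (funext (cumulative_mul_left φ a))

theorem expect_cumulative_sub (T : ℕ) (φ ψ : List (Draw n m) → Draw n m → ℝ) :
    L.expect N T (cumulative fun past c => φ past c - ψ past c) =
      L.expect N T (cumulative φ) - L.expect N T (cumulative ψ) := by
  rw [eq_sub_iff_add_eq, ← expect_add]
  exact congrArg _ (funext fun run => by rw [cumulative_sub, sub_add_cancel])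

variable {L N}

theorem armEstSum_cons (past : List (Draw n m)) (c : Draw n m) :
    L.armEstSum N (c :: past) = L.armEstSum N past + L.roundArmEstimate N past c := rfl

theorem inner_armEstSum (w : EuclideanSpace ℝ (Fin m)) (run : List (Draw n m)) :
    inner ℝ w (L.armEstSum N run) =
      cumulative (fun past c => inner ℝ w (L.roundArmEstimate N past c)) run := by
  induction run with
  | nil => simp [cumulative, armEstSum]
  | cons c past ih => rw [armEstSum_cons, inner_add_right, ih]; rfl

theorem gap_eq_inner (past : List (Draw n m)) (c : Draw n m) :
    L.gap N past c = inner ℝ (L.decision N past c) (N.move past - N.pred c.model past) := by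
  rw [inner_sub_right]; rfl

theorem Regular.gap_sq_le (hL : L.Regular) (past : List (Draw n m)) (c : Draw n m) :
    L.gap N past c ^ 2 ≤ ‖N.move past - N.pred c.model past‖ ^ 2 := by
  rw [gap_eq_inner, sq_le_sq, abs_norm]
  refine (abs_real_inner_le_norm _ _).trans ?_
  have := mul_le_mul_of_nonneg_right (hL.norm_decision_le (N := N) past c)
    (norm_nonneg (N.move past - N.pred c.model past))
  rwa [one_mul] at this

theorem _root_.Environment.Bounded.error_sq_le (hN : N.Bounded) (past : List (Draw n m))
    (k : Fin (m + 1)) : ‖N.move past - N.pred k past‖ ^ 2 ≤ 4 := by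
  have h1 := norm_sub_le (N.move past) (N.pred k past)
  have h2 := hN.move_le past
  have h3 := hN.pred_le k past
  have h4 := norm_nonneg (N.move past - N.pred k past)
  nlinarith

theorem Regular.modelLoss_le (hL : L.Regular) (past : List (Draw n m)) (k : Fin (m + 1)) :
    L.modelLoss N past k ≤ ‖N.move past - N.pred k past‖ ^ 2 := by
  have hn : (n : ℝ) ≠ 0 := by exact_mod_cast hL.dim_pos.ne'
  calc L.modelLoss N past k
      ≤ ∑ _ib : Fin n × Bool, (n : ℝ)⁻¹ * (1 / 2) * ‖N.move past - N.pred k past‖ ^ 2 :=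
        Finset.sum_le_sum fun ib _ => mul_le_mul_of_nonneg_left
          (hL.gap_sq_le past ((⟨0, by simp⟩, true), k, ib)) (by positivity)
    _ = ‖N.move past - N.pred k past‖ ^ 2 := by
        rw [Finset.sum_const, Finset.card_univ, Fintype.card_prod, Fintype.card_fin,
          Fintype.card_bool, nsmul_eq_mul]
        push_cast
        field_simp

theorem Regular.mixedLoss_mixedVertex_le (hL : L.Regular) (hN : N.Bounded)
    (past : List (Draw n m)) (k : Fin (m + 1)) {α : ℝ} (h0 : 0 ≤ α) (h1 : α ≤ 1) :
    L.mixedLoss N past (mixedVertex k α) ≤ ‖N.move past - N.pred k past‖ ^ 2 + 4 * α := by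
  have hle : ∀ j, L.modelLoss N past j ≤ 4 := fun j =>
    (hL.modelLoss_le past j).trans (hN.error_sq_le past j)
  have h2 : ∑ j, α / ((m : ℝ) + 1) * L.modelLoss N past j ≤ ∑ _j : Fin (m + 1),
      α / ((m : ℝ) + 1) * 4 :=
    Finset.sum_le_sum fun j _ => mul_le_mul_of_nonneg_left (hle j) (by positivity)
  have h3 : ∑ _j : Fin (m + 1), α / ((m : ℝ) + 1) * 4 = 4 * α := by
    simp
    field_simp
  have h4 : (1 - α) * L.modelLoss N past k ≤ ‖N.move past - N.pred k past‖ ^ 2 := by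
    have h5 := mul_le_mul_of_nonneg_left (hL.modelLoss_le (N := N) past k) (sub_nonneg.2 h1)
    nlinarith [sq_nonneg ‖N.move past - N.pred k past‖]
  simp only [mixedLoss, armDist_mixedVertex, add_mul, Finset.sum_add_distrib, ite_mul, zero_mul,
    Finset.sum_ite_eq', Finset.mem_univ, if_true]
  linarith

theorem drawExpect_arm (past : List (Draw n m)) (g : Fin (max 1 m) × Bool → ℝ) :
    L.drawExpect N past (fun c => g c.1 * L.gap N past c ^ 2) =
      ∑ jb : Fin (max 1 m) × Bool, ((max 1 m : ℕ) : ℝ)⁻¹ * (1 / 2) *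
        (g jb * L.mixedLoss N past
          (L.armPerturb (armLeader (L.armEstSum N past)) jb.1 jb.2)) := by
  rw [drawExpect_eq]
  refine Finset.sum_congr rfl fun jb _ => ?_
  congr 1
  rw [mixedLoss, Finset.mul_sum]
  refine Finset.sum_congr rfl fun k _ => ?_
  rw [modelLoss, Finset.mul_sum, Finset.mul_sum, Finset.mul_sum]
  refine Finset.sum_congr rfl fun ib _ => ?_
  -- The gap depends on the model and the decision draw only, so the arm index and sign in
  -- `modelLoss` are dummies.
  have : L.gap N past (jb, k, ib) = L.gap N past ((⟨0, by simp⟩, true), k, ib) := rfl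
  rw [this, modelDist]
  ring

theorem sum_armIndex (hm : 0 < m) (g : Fin (max 1 m) × Bool → ℝ) :
    ∑ jb, g jb = ∑ jb : Fin m × Bool, g (Fin.cast (max_eq_right hm).symm jb.1, jb.2) :=
  (Equiv.sum_comp ((finCongr (max_eq_right hm).symm).prodCongr (Equiv.refl Bool)) g).symm

theorem armPerturb_cast (hm : 0 < m) (h : EuclideanSpace ℝ (Fin m)) (j : Fin m) (b : Bool) :
    L.armPerturb h (Fin.cast (max_eq_right hm).symm j) b =
      h + (signOf b * (√(L.armVal h j))⁻¹) • L.armVec h j := by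
  simp [armPerturb]

theorem armEstimate_cast (hm : 0 < m) (h : EuclideanSpace ℝ (Fin m)) (j : Fin m) (b : Bool)
    (loss : ℝ) : L.armEstimate h (Fin.cast (max_eq_right hm).symm j) b loss =
      (((m : ℝ) + 1) * loss * signOf b * √(L.armVal h j)) • L.armVec h j := by
  simp [armEstimate]

theorem Regular.drawExpect_gap_sq (hm : 0 < m) (past : List (Draw n m)) :
    L.drawExpect N past (fun c => L.gap N past c ^ 2) =
      L.mixedLoss N past (armLeader (L.armEstSum N past)) := by
  have h1 := L.drawExpect_arm (N := N) past fun _ => 1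
  simp only [one_mul] at h1
  rw [h1, sum_armIndex hm, ← Finset.mul_sum]
  simp only [armPerturb_cast hm, mixedLoss_eq]
  rw [sum_inner_perturb (σ := fun j => √(L.armVal (armLeader (L.armEstSum N past)) j)),
    max_eq_right hm]
  have : (m : ℝ) ≠ 0 := by exact_mod_cast hm.ne'
  field_simp

/-- The estimator is scaled by the number `m + 1` of arms, whereas the eigenvector is drawn from `m`
directions. Hence it is unbiased only up to the factor (m+1)/m. -/
theorem Regular.drawExpect_inner_roundArmEstimate (hL : L.Regular) (hm : 0 < m)
    (past : List (Draw n m)) (w : EuclideanSpace ℝ (Fin m)) :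
    L.drawExpect N past (fun c => inner ℝ (armLeader (L.armEstSum N past) - w)
        (L.roundArmEstimate N past c)) =
      L.drawExpect N past (fun c => ((m : ℝ) + 1) / m *
        (L.gap N past c ^ 2 - L.mixedLoss N past w)) := by
  set h := armLeader (L.armEstSum N past) with hh
  have hm0 : (m : ℝ) ≠ 0 := by exact_mod_cast hm.ne'
  have hσ : ∀ j, √(L.armVal h j) ≠ 0 := fun j => (Real.sqrt_pos.2
    (selfConcordantOn_simplexBarrier.val_pos hL.armEigen (armLeader_mem _) j)).ne'
  have h1 : L.drawExpect N past (fun c => inner ℝ (h - w) (L.roundArmEstimate N past c)) =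
      L.drawExpect N past (fun c => inner ℝ (h - w) (L.armEstimate h c.1.1 c.1.2 1) *
        L.gap N past c ^ 2) := by
    unfold drawExpect
    refine Finset.sum_congr rfl fun c _ => ?_
    refine congrArg (L.drawProb N past c * ·) ?_
    change inner ℝ (h - w) (L.armEstimate h c.1.1 c.1.2 (L.gap N past c ^ 2)) = _
    simp only [armEstimate]
    split_ifs
    · simp only [real_inner_smul_right]; ring
    · simp
  have h2 : L.drawExpect N past (fun c => ((m : ℝ) + 1) / m *
      (L.gap N past c ^ 2 - L.mixedLoss N past w)) =
      ((m : ℝ) + 1) / m * (L.mixedLoss N past h - L.mixedLoss N past w) := by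
    rw [hh, ← Regular.drawExpect_gap_sq hm, mul_sub]
    conv_rhs => rw [← drawExpect_const (hL.properDraws (N := N)) past (L.mixedLoss N past w)]
    simp only [drawExpect, Finset.mul_sum, ← Finset.sum_sub_distrib]
    exact Finset.sum_congr rfl fun c _ => by ring
  rw [h1, h2, drawExpect_arm (g := fun jb => inner ℝ (h - w) (L.armEstimate h jb.1 jb.2 1)),
    sum_armIndex hm, ← Finset.mul_sum, ← hh]
  simp only [armPerturb_cast hm, armEstimate_cast hm, mixedLoss_eq]
  have h3 := sum_inner_perturb_mul (L.armVec h) hσ h (L.lossVec N past) (h - w)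
    (L.modelLoss N past (Fin.last m))
  have h4 : ∑ jb : Fin m × Bool,
      inner ℝ (h - w) ((((m : ℝ) + 1) * 1 * signOf jb.2 * √(L.armVal h jb.1)) • L.armVec h jb.1) *
        (L.modelLoss N past (Fin.last m) + inner ℝ
          (h + (signOf jb.2 * (√(L.armVal h jb.1))⁻¹) • L.armVec h jb.1) (L.lossVec N past)) =
      ((m : ℝ) + 1) * (2 * inner ℝ (h - w) (L.lossVec N past)) := by
    rw [← h3, Finset.mul_sum]
    refine Finset.sum_congr rfl fun jb _ => ?_
    rw [real_inner_smul_right]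
    ring
  rw [h4, max_eq_right hm, inner_sub_left]
  field_simp
  ring

theorem Regular.cumulative_arm_le (hL : L.Regular) (hN : N.Bounded) (run : List (Draw n m))
    {w : EuclideanSpace ℝ (Fin m)} (hw : w ∈ openSimplex m) :
    cumulative (fun past c => inner ℝ (armLeader (L.armEstSum N past) - w)
        (L.roundArmEstimate N past c)) run ≤
      32 * ((m : ℝ) + 1) ^ 2 * simplexBarrier m w +
        1 / 4 * cumulative (fun past c => L.gap N past c ^ 2) run := by
  set η : ℝ := 1 / (32 * ((m : ℝ) + 1) ^ 2) with hη
  have hη0 : 0 < η := by positivity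
  have hSC := selfConcordantOn_simplexBarrier (m := m)
  obtain ⟨Φ, hΦ⟩ := hSC.exists_potential (openSimplex_nonempty m) η
  have hgap : ∀ past c, L.gap N past c ^ 2 ≤ 4 := fun past c =>
    (hL.gap_sq_le past c).trans (hN.error_sq_le past c.model)
  have hm0 : (0 : ℝ) ≤ m := m.cast_nonneg
  have hηm : η * ((m : ℝ) + 1) ^ 2 = 1 / 32 := by rw [hη]; field_simp
  have hηm' : η * ((m : ℝ) + 1) ≤ 1 / 32 := by
    rw [← hηm]
    exact mul_le_mul_of_nonneg_left (by nlinarith) hη0.le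
  have h1 := cumulative_le_of_step (run := run) (G := fun p => Φ (L.armEstSum N p))
    (φ := fun past c => η * inner ℝ (armLeader (L.armEstSum N past)) (L.roundArmEstimate N past c) -
      η * (1 / 4) * L.gap N past c ^ 2) (fun past c _ => by
    have hδ0 : 0 ≤ η * (((m : ℝ) + 1) * L.gap N past c ^ 2) := by positivity
    have hδ : η * (((m : ℝ) + 1) * L.gap N past c ^ 2) ≤ 1 / 2 := by
      have := mul_le_mul hηm' (hgap past c) (sq_nonneg _) (by norm_num)
      linarith
    have key := hSC.inner_le_potential_sub (openSimplex_nonempty m) (c := η) (M := 0)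
      (S := L.armEstSum N past) (z := L.roundArmEstimate N past c)
      (x := armLeader (L.armEstSum N past)) (by rw [add_zero]; rfl) hδ0 hδ
      (fun v => by
        rw [sub_zero, roundArmEstimate, armEstimate]
        split_ifs with hj
        · have h2 := hSC.abs_inner_le_sqrt_hess hL.armEigen
            (armLeader_mem (L.armEstSum N past)) ⟨_, hj⟩ v
          rw [real_inner_smul_right]
          simp only [abs_mul, abs_signOf, mul_one, abs_of_pos hη0, abs_pow, sq_abs,
            abs_of_nonneg (Real.sqrt_nonneg _), abs_of_nonneg (add_nonneg hm0 zero_le_one)]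
          have h3 := mul_le_mul_of_nonneg_left h2 hδ0
          calc _ = _ := by ring
            _ ≤ _ := h3
        · rw [inner_zero_right, mul_zero, abs_zero]
          exact mul_nonneg hδ0 (Real.sqrt_nonneg _)) hΦ
    refine le_trans ?_ key
    -- Since η(m+1)² = 1/32, the error is η gap⁴/16, and gap² ≤ 4 makes it at most η gap²/4.
    have h4 : 2 * (η * (((m : ℝ) + 1) * L.gap N past c ^ 2)) ^ 2 =
        η * (η * ((m : ℝ) + 1) ^ 2) * 2 * L.gap N past c ^ 2 * L.gap N past c ^ 2 := by ring
    rw [h4, hηm]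
    have h5 := mul_le_mul_of_nonneg_left (hgap past c)
      (mul_nonneg hη0.le (sq_nonneg (L.gap N past c)))
    linarith)
  have h3 : Φ (L.armEstSum N run) ≤ η * inner ℝ w (L.armEstSum N run) + simplexBarrier m w :=
    (hΦ _).2 ⟨w, hw, rfl⟩
  have h4 : 0 ≤ Φ (L.armEstSum N []) := by
    obtain ⟨y, hy, hy'⟩ := (hΦ (L.armEstSum N [])).1
    rw [← hy']
    simpa [armEstSum] using simplexBarrier_nonneg hy
  rw [inner_armEstSum] at h3
  simp only [cumulative_sub, cumulative_mul_left, inner_sub_left] at h1 ⊢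
  have h5 : 32 * ((m : ℝ) + 1) ^ 2 = η⁻¹ := by rw [hη, one_div, inv_inv]
  rw [h5]
  refine le_of_mul_le_mul_left ?_ hη0
  rw [mul_add, ← mul_assoc, mul_inv_cancel₀ hη0.ne']
  linarith

theorem Regular.expect_gap_sq_le_of_pos (hL : L.Regular) (hN : N.Bounded) (hm : 0 < m) {T : ℕ}
    (hT : 0 < T) (k : Fin (m + 1)) :
    L.expect N T (cumulative fun past c => L.gap N past c ^ 2) ≤
      2 * (L.expect N T (cumulative fun past _ => ‖N.move past - N.pred k past‖ ^ 2) +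
        32 * ((m : ℝ) + 1) ^ 3 * Real.log (T * ((m : ℝ) + 1))) := by
  have hp : L.ProperDraws N := hL.properDraws
  have hT' : (1 : ℝ) ≤ T := by exact_mod_cast hT
  have hm' : (1 : ℝ) ≤ m := by exact_mod_cast hm
  have hα0 : (0 : ℝ) < (T : ℝ)⁻¹ := by positivity
  have hα1 : (T : ℝ)⁻¹ ≤ 1 := inv_le_one_of_one_le₀ hT'
  -- Weight 1/T costs at most 4/T per round, hence 4 in total, and keeps the barrier at (m+1)
  -- log(T(m+1)).
  set w : EuclideanSpace ℝ (Fin m) := mixedVertex k (T : ℝ)⁻¹ with hw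
  have h1 := expect_mono hp (T := T) fun run _ =>
    hL.cumulative_arm_le hN run (mixedVertex_mem (k := k) hα0 hα1)
  rw [expect_add, expect_const hp, expect_mul_left, expect_cumulative_congr hp
    (fun past => hL.drawExpect_inner_roundArmEstimate hm past w)] at h1
  rw [expect_cumulative_mul_left, expect_cumulative_sub] at h1
  have h2 : L.expect N T (cumulative fun past _ => L.mixedLoss N past w) ≤
      L.expect N T (cumulative fun past _ => ‖N.move past - N.pred k past‖ ^ 2) + 4 := by
    rw [← expect_const hp T 4, ← expect_add]
    refine expect_mono hp fun run hr => ?_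
    have h3 := cumulative_le_cumulative (run := run) fun past (c : Draw n m) _ =>
      hL.mixedLoss_mixedVertex_le hN past k hα0.le hα1
    rw [cumulative_add, cumulative_const, hr] at h3
    have h4 : (T : ℝ) * (4 * (T : ℝ)⁻¹) = 4 := by field_simp
    rwa [h4] at h3
  have h3 := simplexBarrier_mixedVertex_le (k := k) hα0 hα1
  rw [div_inv_eq_mul, mul_comm _ (T : ℝ)] at h3
  have hG : 0 ≤ L.expect N T (cumulative fun past c => L.gap N past c ^ 2) := by
    rw [← expect_const hp T 0]
    refine expect_mono hp fun run _ => ?_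
    have := cumulative_le_cumulative (run := run) (φ := fun _ _ => 0)
      (ψ := fun past c => L.gap N past c ^ 2) fun past c _ => sq_nonneg _
    simpa [cumulative_const] using this
  have hI : 0 ≤ L.expect N T (cumulative fun past _ => ‖N.move past - N.pred k past‖ ^ 2) := by
    rw [← expect_const hp T 0]
    refine expect_mono hp fun run _ => ?_
    have := cumulative_le_cumulative (run := run) (φ := fun _ _ => 0)
      (ψ := fun past (_ : Draw n m) => ‖N.move past - N.pred k past‖ ^ 2)
      fun past c _ => sq_nonneg _
    simpa [cumulative_const] using this
  set G := L.expect N T (cumulative fun past c => L.gap N past c ^ 2)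
  set I := L.expect N T (cumulative fun past _ => ‖N.move past - N.pred k past‖ ^ 2)
  set Λ := Real.log (T * ((m : ℝ) + 1)) with hΛ
  -- With at least two models and T ≥ 1 the logarithm is at least log 2, so the additive 4 is
  -- absorbed by (m+1)³Λ.
  have hΛ2 : 1 / 2 ≤ Λ := by
    have h5 : Real.log 2 ≤ Λ := Real.log_le_log (by norm_num) (by nlinarith)
    linarith [Real.log_two_gt_d9]
  have hd3 : 8 ≤ ((m : ℝ) + 1) ^ 3 := by
    have := pow_le_pow_left₀ (by norm_num) (show (2 : ℝ) ≤ (m : ℝ) + 1 by linarith) 3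
    linarith
  have hE : 4 ≤ ((m : ℝ) + 1) ^ 3 * Λ := by nlinarith
  have h6 : 32 * ((m : ℝ) + 1) ^ 2 * simplexBarrier m w ≤ 32 * (((m : ℝ) + 1) ^ 3 * Λ) := by
    have := mul_le_mul_of_nonneg_left h3 (show 0 ≤ 32 * ((m : ℝ) + 1) ^ 2 by positivity)
    linarith
  have hr : 1 ≤ ((m : ℝ) + 1) / m := by rw [le_div_iff₀ (by linarith)]; linarith
  rw [mul_assoc 32]
  set E := ((m : ℝ) + 1) ^ 3 * Λ
  set Cst := L.expect N T (cumulative fun past _ => L.mixedLoss N past w)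
  -- If G ≤ Cst the comparator bound suffices. Otherwise (m+1)/m ≥ 1 can be dropped, giving G − Cst
  -- ≤ 32E + G/4, which is solved for G.
  rcases le_total G Cst with hGC | hGC
  · linarith
  · have h7 := mul_le_mul_of_nonneg_right hr (sub_nonneg.2 hGC)
    linarith

/-- The case of a single model needs no bandit argument: gap² is bounded pointwise by the squared
error of that model. -/
theorem Regular.expect_gap_sq_le (hL : L.Regular) (hN : N.Bounded) (T : ℕ) (k : Fin (m + 1)) :
    L.expect N T (cumulative fun past c => L.gap N past c ^ 2) ≤
      2 * (L.expect N T (cumulative fun past _ => ‖N.move past - N.pred k past‖ ^ 2) +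
        32 * ((m : ℝ) + 1) ^ 3 * Real.log (T * ((m : ℝ) + 1))) := by
  rcases T.eq_zero_or_pos with rfl | hT
  · simp [expect, cumulative]
  rcases m.eq_zero_or_pos with rfl | hm
  · have hp : L.ProperDraws N := hL.properDraws
    have hlog : 0 ≤ Real.log T := Real.log_natCast_nonneg T
    have h1 : L.expect N T (cumulative fun past c => L.gap N past c ^ 2) ≤
        2 * L.expect N T (cumulative fun past _ => ‖N.move past - N.pred k past‖ ^ 2) := by
      rw [← expect_mul_left]
      refine expect_mono hp fun run _ => ?_
      rw [← cumulative_mul_left]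
      refine cumulative_le_cumulative fun past c _ => ?_
      have h2 := hL.gap_sq_le (N := N) past c
      rw [Subsingleton.elim (α := Fin 1) c.model k] at h2
      linarith [sq_nonneg ‖N.move past - N.pred k past‖]
    norm_num
    linarith
  · exact hL.expect_gap_sq_le_of_pos hN hm hT k

end Learner

/-! ### The expectation over the seed -/

section Seed

variable {Ω : Type*} (p : PMF Ω)

theorem PMF.summable_toReal_mul {a : Ω → ℝ} {A : ℝ} (ha : ∀ ω, |a ω| ≤ A) :
    Summable fun ω => (p ω).toReal * a ω := by
  have h1 : Summable fun ω => (p ω).toReal := ENNReal.summable_toReal p.tsum_coe_ne_top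
  refine Summable.of_norm_bounded (h1.mul_right A) fun ω => ?_
  rw [norm_mul, Real.norm_eq_abs, Real.norm_eq_abs, abs_of_nonneg ENNReal.toReal_nonneg]
  exact mul_le_mul_of_nonneg_left (ha ω) ENNReal.toReal_nonneg

/-- The uniform bounds guarantee summability; a non-summable `tsum` would be 0 and monotonicity
would fail. -/
theorem PMF.tsum_toReal_mul_le {a b : Ω → ℝ} {A B c d : ℝ} (ha : ∀ ω, |a ω| ≤ A)
    (hb : ∀ ω, |b ω| ≤ B) (hab : ∀ ω, a ω ≤ c + d * b ω) :
    ∑' ω, (p ω).toReal * a ω ≤ c + d * ∑' ω, (p ω).toReal * b ω := by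
  have h1 : Summable fun ω => (p ω).toReal := ENNReal.summable_toReal p.tsum_coe_ne_top
  have h2 : ∑' ω, (p ω).toReal = 1 := by
    rw [← ENNReal.tsum_toReal_eq fun ω => p.apply_ne_top ω, p.tsum_coe, ENNReal.toReal_one]
  have hsb := p.summable_toReal_mul hb
  have h3 : c + d * ∑' ω, (p ω).toReal * b ω =
      ∑' ω, ((p ω).toReal * c + d * ((p ω).toReal * b ω)) := by
    rw [(h1.mul_right c).tsum_add (hsb.mul_left d), tsum_mul_right, tsum_mul_left, h2, one_mul]
  rw [h3]
  refine (p.summable_toReal_mul ha).tsum_le_tsum (fun ω => ?_)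
    ((h1.mul_right c).add (hsb.mul_left d))
  have := mul_le_mul_of_nonneg_left (hab ω) (ENNReal.toReal_nonneg (a := p ω))
  linarith

end Seed

theorem abs_cumulative_le {n m : ℕ} {φ : List (Draw n m) → Draw n m → ℝ} {B : ℝ}
    (h : ∀ past c, |φ past c| ≤ B) (run : List (Draw n m)) :
    |cumulative φ run| ≤ run.length * B := by
  rw [← cumulative_const B run, abs_le]
  constructor
  · rw [← neg_one_mul, ← cumulative_mul_left]
    refine cumulative_le_cumulative fun past c _ => ?_
    rw [neg_one_mul]
    exact (abs_le.1 (h past c)).1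
  · exact cumulative_le_cumulative fun past c _ => (abs_le.1 (h past c)).2

/-- For oblivious moves and predictions the error of a model depends on the number of rounds
only. -/
theorem Environment.Oblivious.cumulative_error_eq {n m : ℕ} {N : Environment n m}
    (hN : N.Oblivious) (k : Fin (m + 1)) : ∀ run run' : List (Draw n m),
    run.length = run'.length →
      cumulative (fun past _ => ‖N.move past - N.pred k past‖ ^ 2) run =
        cumulative (fun past _ => ‖N.move past - N.pred k past‖ ^ 2) run'
  | [], [], _ => rfl
  | [], _ :: _, h => by simp at h
  | _ :: _, [], h => by simp at h
  | c :: past, c' :: past', h => by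
    have hl : past.length = past'.length := by simpa using h
    simp only [cumulative, hN.cumulative_error_eq k past past' hl, (hN past past' hl).1,
      (hN past past' hl).2 k]

namespace Learner

variable {n m : ℕ} {L : Learner n m} {N : Environment n m}

theorem Regular.abs_gap_sq_le (hL : L.Regular) (hN : N.Bounded) (past : List (Draw n m))
    (c : Draw n m) : |L.gap N past c ^ 2| ≤ 4 := by
  rw [abs_of_nonneg (sq_nonneg _)]
  exact (hL.gap_sq_le past c).trans (hN.error_sq_le past c.model)

theorem Regular.abs_regret_le (hL : L.Regular) (hN : N.Bounded) {w : EuclideanSpace ℝ (Fin n)}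
    (hw : w ∈ interior L.F) (past : List (Draw n m)) (c : Draw n m) :
    |inner ℝ (L.decision N past c) (N.move past) - inner ℝ w (N.move past)| ≤ 2 := by
  have hw1 : ‖w‖ ≤ 1 := by simpa using hL.subset_ball (subset_closure hw)
  have h1 := norm_sub_le (L.decision N past c) w
  have h2 := hL.norm_decision_le (N := N) past c
  have h3 := hN.move_le past
  rw [← inner_sub_left]
  refine (abs_real_inner_le_norm _ _).trans ?_
  nlinarith [norm_nonneg (N.move past), norm_nonneg (L.decision N past c - w)]

theorem _root_.Environment.Bounded.abs_error_sq_le (hN : N.Bounded) (past : List (Draw n m))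
    (k : Fin (m + 1)) : |‖N.move past - N.pred k past‖ ^ 2| ≤ 4 := by
  rw [abs_of_nonneg (sq_nonneg _)]
  exact hN.error_sq_le past k

theorem Regular.abs_expect_cumulative_le (hL : L.Regular) (T : ℕ)
    {φ : List (Draw n m) → Draw n m → ℝ} {B : ℝ} (h : ∀ past c, |φ past c| ≤ B) :
    |L.expect N T (cumulative φ)| ≤ T * B :=
  abs_expect_le hL.properDraws fun run hr => hr ▸ abs_cumulative_le h run

theorem _root_.Environment.Bounded.abs_iInf_le (hN : N.Bounded) (run : List (Draw n m)) :
    |⨅ k : Fin (m + 1), cumulative (fun past _ => ‖N.move past - N.pred k past‖ ^ 2) run| ≤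
      run.length * 4 := by
  obtain ⟨k, hk⟩ := exists_eq_ciInf_of_finite (f := fun k : Fin (m + 1) =>
    cumulative (fun past _ => ‖N.move past - N.pred k past‖ ^ 2) run)
  rw [← hk]
  exact abs_cumulative_le (fun past _ => hN.abs_error_sq_le past k) run

/-- Oblivious errors depend on the length of the history only, so the best model on one reference
history of length `T` is best on all of them. -/
theorem Regular.exists_expect_error_le (hL : L.Regular) (hN : N.Oblivious) (T : ℕ) :
    ∃ k : Fin (m + 1),
      L.expect N T (cumulative fun past _ => ‖N.move past - N.pred k past‖ ^ 2) ≤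
      L.expect N T fun run => ⨅ k : Fin (m + 1),
        cumulative (fun past _ => ‖N.move past - N.pred k past‖ ^ 2) run := by
  set run₀ : List (Draw n m) :=
    List.replicate T ((⟨0, by simp⟩, true), 0, (⟨0, hL.dim_pos⟩, true)) with hrun
  obtain ⟨k, hk⟩ := Finite.exists_min fun k : Fin (m + 1) =>
    cumulative (fun past _ => ‖N.move past - N.pred k past‖ ^ 2) run₀
  refine ⟨k, expect_mono hL.properDraws fun run hr => le_ciInf fun j => ?_⟩
  have hlen : run.length = run₀.length := by simp [hrun, hr]
  rw [hN.cumulative_error_eq k run run₀ hlen, hN.cumulative_error_eq j run run₀ hlen]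
  exact hk j

end Learner

end

theorem mainTheorem9 {n m : ℕ} (hn : 0 < n) (T : ℕ)
    (L : Learner n m) (ϑ : ℝ) (X : Set (EuclideanSpace ℝ (Fin n)))
    (hFconv : Convex ℝ L.F) (hFcomp : IsCompact L.F)
    (hFball : L.F ⊆ Metric.closedBall 0 1) (hXball : X ⊆ Metric.closedBall 0 1)
    (hR : IsSelfConcordantBarrier ϑ L.F L.R)
    (hRmin : IsLeast (L.R '' interior L.F) 0)
    (hη : 0 < L.η)
    (hvec : IsHessianEigenbasis (interior L.F) L.R L.vec L.val)
    (harmVec : IsHessianEigenbasis (openSimplex m) (simplexBarrier m) L.armVec L.armVal)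
    {Ω : Type*} (p : PMF Ω) (N : Ω → Environment n m)
    (hmove : ∀ ω past, (N ω).move past ∈ X)
    (hpred : ∀ ω k past, (N ω).pred k past ∈ Metric.closedBall 0 1)
    (hpred_first : ∀ ω k, (N ω).pred k [] = 0)
    (hstep : ∀ ω past c, past.length < T → L.η * (n * |L.gap (N ω) past c|) < 1 / 4)
    (fstar : EuclideanSpace ℝ (Fin n)) (hfstar : fstar ∈ interior L.F) :
    -- the regret bound in terms of the observed errors, for adaptive Nature and models
    gameExpect p L N T (fun ω => cumulative fun past c =>
        inner ℝ (L.decision (N ω) past c) ((N ω).move past) - inner ℝ fstar ((N ω).move past))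
      ≤ L.η⁻¹ * L.R fstar + 2 * L.η * (n : ℝ) ^ 2 *
          gameExpect p L N T (fun ω => cumulative fun past c =>
            (inner ℝ (L.decision (N ω) past c)
              ((N ω).move past - (N ω).pred c.model past)) ^ 2) ∧
    -- the bound in terms of the best model, `𝔼 inf`, for oblivious Nature and models
    ((∀ ω, (N ω).Oblivious) →
      L.η⁻¹ * L.R fstar + 2 * L.η * (n : ℝ) ^ 2 *
          gameExpect p L N T (fun ω => cumulative fun past c =>
            (inner ℝ (L.decision (N ω) past c)
              ((N ω).move past - (N ω).pred c.model past)) ^ 2)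
        ≤ L.η⁻¹ * L.R fstar + 4 * L.η * (n : ℝ) ^ 2 *
          (gameExpect p L N T (fun ω run => ⨅ k : Fin (m + 1),
              cumulative (fun past _ => ‖(N ω).move past - (N ω).pred k past‖ ^ 2) run)
            + 32 * ((m : ℝ) + 1) ^ 3 * Real.log (T * ((m : ℝ) + 1)))) ∧
    -- the bound in terms of the best model, `inf 𝔼`, for adaptive Nature and models
    (L.η⁻¹ * L.R fstar + 2 * L.η * (n : ℝ) ^ 2 *
          gameExpect p L N T (fun ω => cumulative fun past c =>
            (inner ℝ (L.decision (N ω) past c)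
              ((N ω).move past - (N ω).pred c.model past)) ^ 2)
        ≤ L.η⁻¹ * L.R fstar + 4 * L.η * (n : ℝ) ^ 2 *
          ((⨅ k : Fin (m + 1), gameExpect p L N T (fun ω =>
              cumulative fun past _ => ‖(N ω).move past - (N ω).pred k past‖ ^ 2))
            + 32 * ((m : ℝ) + 1) ^ 3 * Real.log (T * ((m : ℝ) + 1)))) := by
  have hL : L.Regular :=
    { dim_pos := hn
      barrier := hR.selfConcordantOn hFconv hFcomp
      nonempty := ⟨fstar, hfstar⟩
      subset_ball := (closure_minimal interior_subset hFcomp.isClosed).trans hFball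
      nonneg := fun x hx => hRmin.2 ⟨x, hx, rfl⟩
      η_pos := hη
      eigen := hvec
      armEigen := harmVec }
  have hN : ∀ ω, (N ω).Bounded := fun ω =>
    { move_le := fun past => by simpa using hXball (hmove ω past)
      pred_le := fun k past => by simpa using hpred ω k past
      pred_first := hpred_first ω }
  simp only [← Learner.gap_eq_inner, gameExpect]
  have hG : ∀ ω, |L.expect (N ω) T (cumulative fun past c => L.gap (N ω) past c ^ 2)| ≤ T * 4 :=
    fun ω => hL.abs_expect_cumulative_le T (hL.abs_gap_sq_le (hN ω))
  have hc : 0 ≤ 2 * L.η * (n : ℝ) ^ 2 := by positivity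
  have key : ∀ {G I : ℝ}, G ≤ 2 * (32 * ((m : ℝ) + 1) ^ 3 * Real.log (T * ((m : ℝ) + 1))) + 2 * I →
      L.η⁻¹ * L.R fstar + 2 * L.η * (n : ℝ) ^ 2 * G ≤ L.η⁻¹ * L.R fstar + 4 * L.η * (n : ℝ) ^ 2 *
        (I + 32 * ((m : ℝ) + 1) ^ 3 * Real.log (T * ((m : ℝ) + 1))) := fun h => by
    have := mul_le_mul_of_nonneg_left h hc
    linarith
  refine ⟨?_, fun hobl => key ?_, key ?_⟩
  · exact p.tsum_toReal_mul_le
      (fun ω => hL.abs_expect_cumulative_le T (hL.abs_regret_le (hN ω) hfstar)) hG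
      fun ω => hL.expect_regret_le (hN ω) (hstep ω) hfstar
  · refine p.tsum_toReal_mul_le hG (fun ω => Learner.abs_expect_le hL.properDraws fun run hr =>
      hr ▸ (hN ω).abs_iInf_le run) fun ω => ?_
    -- Here `k` may depend on the seed, which keeps the infimum inside the expectation.
    obtain ⟨k, hk⟩ := hL.exists_expect_error_le (hobl ω) T
    have := hL.expect_gap_sq_le (hN ω) T k
    linarith
  -- Here `k` attains the infimum of the fully averaged errors and is therefore the same for all
  -- seeds.
  · obtain ⟨k, hk⟩ := exists_eq_ciInf_of_finite (f := fun k : Fin (m + 1) =>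
      ∑' ω, (p ω).toReal * L.expect (N ω) T
        (cumulative fun past _ => ‖(N ω).move past - (N ω).pred k past‖ ^ 2))
    rw [← hk]
    refine p.tsum_toReal_mul_le hG (fun ω => hL.abs_expect_cumulative_le T
      fun past _ => (hN ω).abs_error_sq_le past k) fun ω => ?_
    have := hL.expect_gap_sq_le (hN ω) T k
    linarith
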